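/- Let $F\in\mathbb{C}[x,y,z]$ be a ternary cubic, i.e. a nonzero homogeneous polynomial of degree $3$ in three variables, and let \[ G_F=\{A\in SL(3,\mathbb{C}) : F(A\mathbf{x})=F(\mathbf{x})\ \text{for all } \mathbf{x}\in\mathbb{C}^3\} \] be the group of its $SL(3,\mathbb{C})$ symmetries. Then $F$ is the product of a linear form and an irreducible quadratic form if and only if $G_F$ is a one-dimensional complex Lie group; that is, $G_F$, with the topology inherited from the space $M_3(\mathbb{C})$ of $3\times 3$ matrices, carries a complex Lie group structure of complex dimension $1$ for which the inclusion $G_F\hookrightarrow M_3(\mathbb{C})$ is a holomorphic immersion. -/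

import Mathlib

open scoped Manifold ContDiff

/-- The group of `SL(n, ℂ)` symmetries of a polynomial `F` in `n` complex variables: all
`A ∈ SL(n, ℂ)` with `F (A x) = F x` for every `x ∈ ℂⁿ`. -/
def symmetryGroupSL {n : ℕ} (F : MvPolynomial (Fin n) ℂ) :
    Subgroup (Matrix.SpecialLinearGroup (Fin n) ℂ) where
  carrier := {A | ∀ x : Fin n → ℂ,
    MvPolynomial.eval (Matrix.mulVec (A : Matrix (Fin n) (Fin n) ℂ) x) F = MvPolynomial.eval x F}
  one_mem' := by
    intro x
    simp
  mul_mem' := by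
    intro A B hA hB x
    rw [Matrix.SpecialLinearGroup.coe_mul, ← Matrix.mulVec_mulVec, hA, hB]
  inv_mem' := by
    intro A hA x
    have h := hA (Matrix.mulVec ((A⁻¹ : Matrix.SpecialLinearGroup (Fin n) ℂ) :
      Matrix (Fin n) (Fin n) ℂ) x)
    rw [Matrix.mulVec_mulVec, ← Matrix.SpecialLinearGroup.coe_mul, mul_inv_cancel,
      Matrix.SpecialLinearGroup.coe_one, Matrix.one_mulVec] at h
    exact h.symm

/-- The matrix entries of an element of a subgroup `G` of `SL(n, ℂ)`: the inclusion of `G` in the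
complex vector space of all `n × n` matrices. -/
def matrixInclusion {n : ℕ} (G : Subgroup (Matrix.SpecialLinearGroup (Fin n) ℂ)) :
    G → (Fin n → Fin n → ℂ) :=
  fun A i j => (A : Matrix.SpecialLinearGroup (Fin n) ℂ) i j

/-- The subgroup `G` of `SL(n, ℂ)` is a complex Lie group of (complex) dimension `d`: with the
topology that it inherits from the matrices, `G` carries an atlas of charts in `ℂᵈ` which makes it a
complex Lie group and the inclusion in the space of matrices a holomorphic immersion. -/
def IsLieSubgroupOfDim {n : ℕ} (G : Subgroup (Matrix.SpecialLinearGroup (Fin n) ℂ)) (d : ℕ) :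
    Prop :=
  ∃ _ : ChartedSpace (Fin d → ℂ) G,
    LieGroup 𝓘(ℂ, Fin d → ℂ) ω G ∧
    ContMDiff 𝓘(ℂ, Fin d → ℂ) 𝓘(ℂ, Fin n → Fin n → ℂ) ω (matrixInclusion G) ∧
    ∀ A : G, Function.Injective
      (mfderiv 𝓘(ℂ, Fin d → ℂ) 𝓘(ℂ, Fin n → Fin n → ℂ) (matrixInclusion G) A)

/-- A form in `n` complex variables which is a product of a linear form and an irreducible quadratic
form. -/
def SplitsLinearIrreducibleQuadratic {n : ℕ} (F : MvPolynomial (Fin n) ℂ) : Prop :=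
  ∃ L Q : MvPolynomial (Fin n) ℂ,
    L.IsHomogeneous 1 ∧ Q.IsHomogeneous 2 ∧ Irreducible Q ∧ F = L * Q

/-! Suppose first that `F` is a line times an irreducible conic. Over the complex numbers the pair
has two normal forms, `X 2 * (X 0 * X 1 + e * X 2 ^ 2)` when the line is transversal to the conic
and `X 2 * (X 0 * X 2 + X 1 ^ 2)` when it is tangent (`exists_cubic_normal_form`). A symmetry
preserves the line and, up to a scalar, the conic, so its matrix can be computed: it depends on a
cube root of unity `μ` and one free parameter `s` (`transversal_symmetry_iff`,
`tangent_symmetry_iff`). Since `s` is a matrix entry in these coordinates, it serves as a global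
local coordinate, and the Lie structure follows (`isLieSubgroupOfDim_of_sections`).

Conversely, dimension one yields a nonzero tangent vector at the identity: a traceless matrix `X`
whose linear vector field annihilates `F`. Make `X` lower triangular, with off-diagonal entries only
between equal eigenvalues. If some eigenvalue is nonzero, weights of monomials force a coordinate to
divide `F` (`monomials_weight_zero`). If `X` is nilpotent of rank two, the same happens by a direct
computation. If it has rank one, `F` is constant along a direction, hence a cone.

What remains is excluded by exhibiting two independent tangent directions. A cone with vertex
direction `v` admits the transvections `x ↦ x + t (m ⬝ᵥ x) v` with `m ⬝ᵥ v = 0`, and a triangle of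
lines admits a two-dimensional torus. Three lines always form one of these, so the quadratic
cofactor of the linear factor must be irreducible. -/

namespace TernaryCubic

open MvPolynomial Matrix Topology Filter

/-! ### Linear forms and linear substitutions -/

section LinearSubstitution

variable {n : ℕ}

/-- The linear form with coefficient vector `u`. -/
noncomputable def linearForm (u : Fin n → ℂ) : MvPolynomial (Fin n) ℂ :=
  ∑ i, C (u i) * X i

/-- Linear substitution: the algebra map `F ↦ F ∘ P`. -/
noncomputable def linSubst (P : Matrix (Fin n) (Fin n) ℂ) :
    MvPolynomial (Fin n) ℂ →ₐ[ℂ] MvPolynomial (Fin n) ℂ :=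
  aeval fun i => linearForm (P i)

theorem eval_linearForm (u x : Fin n → ℂ) : eval x (linearForm u) = u ⬝ᵥ x := by
  simp [linearForm, dotProduct]

theorem linearForm_isHomogeneous (u : Fin n → ℂ) : (linearForm u).IsHomogeneous 1 :=
  IsHomogeneous.sum _ _ _ fun _ _ => isHomogeneous_C_mul_X _ _

theorem linearForm_injective : Function.Injective (linearForm : (Fin n → ℂ) → _) := by
  intro u v h
  funext i
  simpa [eval_linearForm] using congrArg (eval (Pi.single i 1)) h

theorem linearForm_smul (c : ℂ) (u : Fin n → ℂ) : linearForm (c • u) = C c * linearForm u :=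
  MvPolynomial.funext fun x => by simp [eval_linearForm]

theorem linearForm_zero : linearForm (0 : Fin n → ℂ) = 0 := by
  simp [linearForm]

theorem exists_eq_linearForm {F : MvPolynomial (Fin n) ℂ} (hF : F.IsHomogeneous 1) :
    ∃ u, F = linearForm u := by
  have h : F ∈ Submodule.span ℂ (Set.range (X : Fin n → MvPolynomial (Fin n) ℂ)) := by
    rw [← homogeneousSubmodule_one_eq_span_X]; exact hF
  obtain ⟨u, rfl⟩ := (Submodule.mem_span_range_iff_exists_fun ℂ).1 h
  exact ⟨u, by simp [linearForm, smul_eq_C_mul]⟩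

theorem linSubst_X (P : Matrix (Fin n) (Fin n) ℂ) (i : Fin n) :
    linSubst P (X i) = linearForm (P i) := by
  simp [linSubst]

theorem linSubst_C (P : Matrix (Fin n) (Fin n) ℂ) (c : ℂ) : linSubst P (C c) = C c := by
  simp [linSubst]

theorem eval_linSubst (P : Matrix (Fin n) (Fin n) ℂ) (F : MvPolynomial (Fin n) ℂ)
    (x : Fin n → ℂ) : eval x (linSubst P F) = eval (P *ᵥ x) F := by
  induction F using MvPolynomial.induction_on with
  | C a => simp
  | add p q hp hq => simp [hp, hq]
  | mul_X p i hp => simp [hp, linSubst_X, eval_linearForm, mulVec]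

theorem linSubst_linSubst (P Q : Matrix (Fin n) (Fin n) ℂ) (F : MvPolynomial (Fin n) ℂ) :
    linSubst P (linSubst Q F) = linSubst (Q * P) F :=
  MvPolynomial.funext fun x => by simp [eval_linSubst]

theorem linSubst_one (F : MvPolynomial (Fin n) ℂ) : linSubst 1 F = F :=
  MvPolynomial.funext fun x => by simp [eval_linSubst]

theorem linSubst_linearForm (P : Matrix (Fin n) (Fin n) ℂ) (u : Fin n → ℂ) :
    linSubst P (linearForm u) = linearForm (u ᵥ* P) :=
  MvPolynomial.funext fun x => by simp [eval_linSubst, eval_linearForm, dotProduct_mulVec]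

theorem linSubst_isHomogeneous {F : MvPolynomial (Fin n) ℂ} {d : ℕ} (hF : F.IsHomogeneous d)
    (P : Matrix (Fin n) (Fin n) ℂ) : (linSubst P F).IsHomogeneous d := by
  have h := hF.aeval (fun i => linearForm (P i)) fun i => linearForm_isHomogeneous (P i)
  rwa [one_mul] at h

theorem linSubst_injective {P Q : Matrix (Fin n) (Fin n) ℂ} (h : P * Q = 1) :
    Function.Injective (linSubst P) :=
  Function.LeftInverse.injective (g := linSubst Q) fun F => by
    rw [linSubst_linSubst, h, linSubst_one]

theorem mem_symmetryGroupSL_iff {F : MvPolynomial (Fin n) ℂ}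
    {A : Matrix.SpecialLinearGroup (Fin n) ℂ} :
    A ∈ symmetryGroupSL F ↔ linSubst (A : Matrix (Fin n) (Fin n) ℂ) F = F :=
  ⟨fun h => MvPolynomial.funext fun x => by rw [eval_linSubst]; exact h x,
    fun h x => by rw [← eval_linSubst, h]⟩

/-- An invertible matrix with prescribed row. -/
theorem exists_det_ne_zero_row_eq {u : Fin n → ℂ} (hu : u ≠ 0) (i : Fin n) :
    ∃ P : Matrix (Fin n) (Fin n) ℂ, P.det ≠ 0 ∧ P i = u := by
  obtain ⟨j, hj⟩ := Function.ne_iff.1 hu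
  refine ⟨(((1 : Matrix (Fin n) (Fin n) ℂ).updateRow j u).submatrix (Equiv.swap i j) id), ?_, ?_⟩
  · rw [det_permute]
    have h1 : ((1 : Matrix (Fin n) (Fin n) ℂ).updateRow j u).det = u j := by
      have := cramer_transpose_apply (1 : Matrix (Fin n) (Fin n) ℂ) u j
      simpa using this.symm
    rw [h1]
    exact mul_ne_zero (by simp) hj
  · ext k
    simp

end LinearSubstitution

/-! ### Ternary quadratic and cubic forms in coefficients -/

/-- A quadratic form in three variables, written out. -/
theorem exists_eq_of_isHomogeneous_two {Q : MvPolynomial (Fin 3) ℂ} (hQ : Q.IsHomogeneous 2) :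
    ∃ a b c d e f : ℂ, Q = C a * X 0 ^ 2 + C b * (X 0 * X 1) + C c * X 1 ^ 2 +
      C d * (X 0 * X 2) + C e * (X 1 * X 2) + C f * X 2 ^ 2 := by
  have h : Q ∈ homogeneousSubmodule (Fin 3) ℂ 1 * homogeneousSubmodule (Fin 3) ℂ 1 := by
    rw [← sq, homogeneousSubmodule_one_pow]; exact hQ
  induction h using Submodule.mul_induction_on' with
  | mem_mul_mem m hm k hk =>
    obtain ⟨u, rfl⟩ := exists_eq_linearForm hm
    obtain ⟨v, rfl⟩ := exists_eq_linearForm hk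
    refine ⟨u 0 * v 0, u 0 * v 1 + u 1 * v 0, u 1 * v 1, u 0 * v 2 + u 2 * v 0,
      u 1 * v 2 + u 2 * v 1, u 2 * v 2, ?_⟩
    simp only [linearForm, Fin.sum_univ_three, map_add, map_mul]
    ring
  | add x hx y hy ihx ihy =>
    have hom : ∀ z ∈ homogeneousSubmodule (Fin 3) ℂ 1 * homogeneousSubmodule (Fin 3) ℂ 1,
        z.IsHomogeneous 2 := by
      intro z hz; rw [← sq, homogeneousSubmodule_one_pow] at hz; exact hz
    obtain ⟨a, b, c, d, e, f, rfl⟩ := ihx (hom _ hx)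
    obtain ⟨a', b', c', d', e', f', rfl⟩ := ihy (hom _ hy)
    refine ⟨a + a', b + b', c + c', d + d', e + e', f + f', ?_⟩
    simp only [map_add]
    ring

/-- A cubic form in three variables, written out. -/
theorem exists_eq_of_isHomogeneous_three {F : MvPolynomial (Fin 3) ℂ} (hF : F.IsHomogeneous 3) :
    ∃ a b c d e f g h k l : ℂ, F = C a * X 0 ^ 3 + C b * (X 0 ^ 2 * X 1) + C c * (X 0 ^ 2 * X 2) +
      C d * (X 0 * X 1 ^ 2) + C e * (X 0 * X 1 * X 2) + C f * (X 0 * X 2 ^ 2) +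
      C g * X 1 ^ 3 + C h * (X 1 ^ 2 * X 2) + C k * (X 1 * X 2 ^ 2) + C l * X 2 ^ 3 := by
  have h : F ∈ homogeneousSubmodule (Fin 3) ℂ 2 * homogeneousSubmodule (Fin 3) ℂ 1 := by
    rw [← homogeneousSubmodule_one_pow (σ := Fin 3) (R := ℂ) 2, ← pow_succ, homogeneousSubmodule_one_pow]; exact hF
  induction h using Submodule.mul_induction_on' with
  | mem_mul_mem m hm j hj =>
    obtain ⟨a, b, c, d, e, f, rfl⟩ := exists_eq_of_isHomogeneous_two hm
    obtain ⟨v, rfl⟩ := exists_eq_linearForm hj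
    refine ⟨a * v 0, a * v 1 + b * v 0, a * v 2 + d * v 0, b * v 1 + c * v 0,
      b * v 2 + d * v 1 + e * v 0, d * v 2 + f * v 0, c * v 1, c * v 2 + e * v 1,
      e * v 2 + f * v 1, f * v 2, ?_⟩
    simp only [linearForm, Fin.sum_univ_three, map_add, map_mul]
    ring
  | add x hx y hy ihx ihy =>
    have hom : ∀ z ∈ homogeneousSubmodule (Fin 3) ℂ 2 * homogeneousSubmodule (Fin 3) ℂ 1,
        z.IsHomogeneous 3 := by
      intro z hz
      rw [← homogeneousSubmodule_one_pow (σ := Fin 3) (R := ℂ) 2, ← pow_succ, homogeneousSubmodule_one_pow] at hz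
      exact hz
    obtain ⟨a, b, c, d, e, f, g, h, k, l, rfl⟩ := ihx (hom _ hx)
    obtain ⟨a', b', c', d', e', f', g', h', k', l', rfl⟩ := ihy (hom _ hy)
    refine ⟨a + a', b + b', c + c', d + d', e + e', f + f', g + g', h + h', k + k', l + l', ?_⟩
    simp only [map_add]
    ring

/-! ### Complex manifolds charted by one local homeomorphism -/

theorem exists_isOpen_injOn_of_eventually {X Y : Type*} [TopologicalSpace X] {f : X → Y} {x : X}
    {M : Type*} {ι : X → M} (hι : Function.Injective ι) {σ : Y → M}
    (h : ∀ᶠ y in 𝓝 x, σ (f y) = ι y) : ∃ U, IsOpen U ∧ x ∈ U ∧ Set.InjOn f U := by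
  obtain ⟨U, hU, hUo, hxU⟩ := mem_nhds_iff.1 h
  refine ⟨U, hUo, hxU, fun y hy z hz hyz => hι ?_⟩
  rw [← hU hy, ← hU hz, hyz]

theorem isLocalHomeomorph_of_isOpenMap {X Y : Type*} [TopologicalSpace X] [TopologicalSpace Y]
    {f : X → Y} (hf : Continuous f) (ho : IsOpenMap f)
    (hinj : ∀ x, ∃ U, IsOpen U ∧ x ∈ U ∧ Set.InjOn f U) : IsLocalHomeomorph f := by
  rw [isLocalHomeomorph_iff_isOpenEmbedding_restrict]
  intro x
  obtain ⟨U, hU, hxU, hi⟩ := hinj x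
  exact ⟨U, hU.mem_nhds hxU, .of_continuous_injective_isOpenMap (by fun_prop)
    (Set.injOn_iff_injective.1 hi) (ho.domRestrict hU)⟩

/-- The charted space structure given by the restrictions of a local homeomorphism. -/
noncomputable abbrev chartedSpaceOfLocalHomeomorph {M H : Type*} [TopologicalSpace M]
    [TopologicalSpace H] {f : M → H} (hf : IsLocalHomeomorph f) : ChartedSpace H M where
  atlas := {e | ⇑e = f}
  chartAt x := (hf x).choose
  mem_chart_source x := (hf x).choose_spec.1
  chart_mem_atlas x := (hf x).choose_spec.2.symm

/-- All charts are restrictions of the same map `f`, so every transition map is a restriction of the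
identity. -/
theorem isManifold_of_localHomeomorph {M E : Type*} [TopologicalSpace M]
    [NormedAddCommGroup E] [NormedSpace ℂ E] {f : M → E} (hf : IsLocalHomeomorph f) :
    letI := chartedSpaceOfLocalHomeomorph hf
    IsManifold 𝓘(ℂ, E) ω M := by
  let _ := chartedSpaceOfLocalHomeomorph hf
  have hg : HasGroupoid M (contDiffGroupoid ω 𝓘(ℂ, E)) := by
    constructor
    intro e e' he he'
    refine StructureGroupoid.mem_of_eqOnSource _
      (ofSet_mem_contDiffGroupoid (I := 𝓘(ℂ, E)) (n := ω) (e.symm.trans e').open_source) ⟨rfl, ?_⟩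
    intro y hy
    have hy' : y ∈ e.target := by
      have := hy
      simp only [OpenPartialHomeomorph.trans_source, OpenPartialHomeomorph.symm_source] at this
      exact this.1
    have h1 : ⇑e = f := he
    have h2 : ⇑e' = f := he'
    simp only [OpenPartialHomeomorph.coe_trans, Function.comp_apply, h2, ← h1,
      OpenPartialHomeomorph.ofSet_apply, id]
    exact e.right_inv hy'
  exact { hg with }

theorem contMDiff_into_localHomeomorph {M E : Type*} [TopologicalSpace M]
    [NormedAddCommGroup E] [NormedSpace ℂ E] {f : M → E} (hf : IsLocalHomeomorph f)
    {E' H' N : Type*} [NormedAddCommGroup E'] [NormedSpace ℂ E'] [TopologicalSpace H']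
    [TopologicalSpace N] {I : ModelWithCorners ℂ E' H'} [ChartedSpace H' N] {g : N → M}
    (hg : Continuous g) (hfg : ContMDiff I 𝓘(ℂ, E) ω (f ∘ g)) :
    letI := chartedSpaceOfLocalHomeomorph hf
    ContMDiff I 𝓘(ℂ, E) ω g := by
  let _ := chartedSpaceOfLocalHomeomorph hf
  intro x
  rw [contMDiffAt_iff_target]
  refine ⟨hg.continuousAt, ?_⟩
  have : ⇑(extChartAt 𝓘(ℂ, E) (g x)) = f := by
    rw [extChartAt_coe]; exact (hf (g x)).choose_spec.2.symm
  rw [this]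
  exact hfg x

theorem contMDiff_localHomeomorph {M E : Type*} [TopologicalSpace M]
    [NormedAddCommGroup E] [NormedSpace ℂ E] {f : M → E} (hf : IsLocalHomeomorph f) :
    letI := chartedSpaceOfLocalHomeomorph hf
    ContMDiff 𝓘(ℂ, E) 𝓘(ℂ, E) ω f := by
  let _ := chartedSpaceOfLocalHomeomorph hf
  have := isManifold_of_localHomeomorph hf
  intro x
  have : ⇑(extChartAt 𝓘(ℂ, E) x) = f := by
    rw [extChartAt_coe]; exact (hf x).choose_spec.2.symm
  have h := contMDiffAt_extChartAt (I := 𝓘(ℂ, E)) (n := ω) (x := x)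
  rwa [this] at h

theorem injective_mfderiv_localHomeomorph {M E : Type*} [TopologicalSpace M]
    [NormedAddCommGroup E] [NormedSpace ℂ E] {f : M → E} (hf : IsLocalHomeomorph f) (x : M) :
    letI := chartedSpaceOfLocalHomeomorph hf
    Function.Injective (mfderiv 𝓘(ℂ, E) 𝓘(ℂ, E) f x) := by
  let _ := chartedSpaceOfLocalHomeomorph hf
  have := isManifold_of_localHomeomorph hf
  have : IsManifold 𝓘(ℂ, E) 1 M := .of_le (n := ω) le_top
  have : ⇑(extChartAt 𝓘(ℂ, E) x) = f := by
    rw [extChartAt_coe]; exact (hf x).choose_spec.2.symm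
  have h := isInvertible_mfderiv_extChartAt (I := 𝓘(ℂ, E)) (mem_extChartAt_source x)
  rw [this] at h
  exact h.injective

/-! ### Lie structures on subgroups of the special linear group -/

theorem continuous_matrixInclusion {n : ℕ} (G : Subgroup (SpecialLinearGroup (Fin n) ℂ)) :
    Continuous (matrixInclusion G) := by
  have h : Continuous fun A : G => ((A : SpecialLinearGroup (Fin n) ℂ) : Matrix (Fin n) (Fin n) ℂ) :=
    continuous_subtype_val.comp continuous_subtype_val
  exact h

theorem isInducing_matrixInclusion {n : ℕ} (G : Subgroup (SpecialLinearGroup (Fin n) ℂ)) :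
    IsInducing (matrixInclusion G) := by
  have h : IsInducing fun A : G =>
      ((A : SpecialLinearGroup (Fin n) ℂ) : Matrix (Fin n) (Fin n) ℂ) :=
    IsInducing.subtypeVal.comp IsInducing.subtypeVal
  exact h

theorem matrixInclusion_injective {n : ℕ} (G : Subgroup (SpecialLinearGroup (Fin n) ℂ)) :
    Function.Injective (matrixInclusion G) := by
  intro A B h
  exact Subtype.ext (Subtype.ext h)

theorem contDiff_mul_entries (n : ℕ) :
    ContDiff ℂ ω fun p : (Fin n → Fin n → ℂ) × (Fin n → Fin n → ℂ) =>
      (fun i j => ∑ k, p.1 i k * p.2 k j : Fin n → Fin n → ℂ) := by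
  fun_prop

/-- On `SL(n, ℂ)` the inverse is the adjugate, which is polynomial in the entries; this makes
inversion holomorphic. -/
theorem contDiff_adjugate_entries (n : ℕ) :
    ContDiff ℂ ω fun A : Fin n → Fin n → ℂ =>
      (fun i j => (Matrix.of A).adjugate i j : Fin n → Fin n → ℂ) := by
  have h : ∀ (i j k l : Fin n), ContDiff ℂ ω fun A : Fin n → Fin n → ℂ =>
      (Matrix.of A).updateRow j (Pi.single i 1) k l := by
    intro i j k l
    simp only [updateRow_apply, of_apply]
    split_ifs
    · exact contDiff_const
    · fun_prop
  simp only [adjugate_apply, det_apply']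
  fun_prop

/-- A subgroup of `SL(n, ℂ)` with `d` matrix coordinates in which it is, near each of its elements,
the image of a holomorphic section, is a complex Lie group of dimension `d`. -/
theorem isLieSubgroupOfDim_of_sections {n d : ℕ} (G : Subgroup (SpecialLinearGroup (Fin n) ℂ))
    (l : (Fin n → Fin n → ℂ) →L[ℂ] (Fin d → ℂ))
    (h : ∀ A : G, ∃ σ : (Fin d → ℂ) → Fin n → Fin n → ℂ,
      ContDiffAt ℂ ω σ (l (matrixInclusion G A)) ∧
      (∀ᶠ B in 𝓝 A, σ (l (matrixInclusion G B)) = matrixInclusion G B) ∧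
      ∀ᶠ t in 𝓝 (l (matrixInclusion G A)), ∃ B : G, matrixInclusion G B = σ t ∧ l (σ t) = t) :
    IsLieSubgroupOfDim G d := by
  set f : G → Fin d → ℂ := fun A => l (matrixInclusion G A) with hfdef
  have hfc : Continuous f := l.continuous.comp (continuous_matrixInclusion G)
  have hf : IsLocalHomeomorph f := by
    refine isLocalHomeomorph_of_isOpenMap hfc (IsOpenMap.of_nhds_le fun A => ?_) fun A => ?_
    -- Openness: for `t` near `f A` the section gives a group element `B` over `t` whose matrix `σ
    -- t` is close to that of `A`, so `B` lies in the given neighbourhood.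
    · obtain ⟨σ, hσ, h1, h2⟩ := h A
      intro N hN
      rw [Filter.mem_map, (isInducing_matrixInclusion G).nhds_eq_comap] at hN
      obtain ⟨W, hW, hWN⟩ := hN
      have hσA : σ (f A) = matrixInclusion G A := h1.self_of_nhds
      have h3 : ∀ᶠ t in 𝓝 (f A), σ t ∈ W := hσ.continuousAt.eventually (by rwa [hσA])
      filter_upwards [h2, h3] with t ⟨B, hB, hBt⟩ ht
      have : f B ∈ N := hWN (by rw [Set.mem_preimage, hB]; exact ht)
      rwa [show f B = t by rw [← hBt, ← hB]] at this
    · obtain ⟨σ, -, h1, -⟩ := h A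
      exact exists_isOpen_injOn_of_eventually (matrixInclusion_injective G) h1
  let _ := chartedSpaceOfLocalHomeomorph hf
  have hM := isManifold_of_localHomeomorph hf
  have hι : ContMDiff 𝓘(ℂ, Fin d → ℂ) 𝓘(ℂ, Fin n → Fin n → ℂ) ω (matrixInclusion G) := by
    intro A
    obtain ⟨σ, hσ, h1, -⟩ := h A
    refine (ContMDiffAt.comp A (g := σ) (f := f) hσ.contMDiffAt
      (contMDiff_localHomeomorph hf A)).congr_of_eventuallyEq ?_
    filter_upwards [h1] with B hB using hB.symm
  refine ⟨inferInstance, ?_, hι, fun A => ?_⟩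
  · have hmul : ContMDiff (𝓘(ℂ, Fin d → ℂ).prod 𝓘(ℂ, Fin d → ℂ)) 𝓘(ℂ, Fin d → ℂ) ω
        fun p : G × G => p.1 * p.2 := by
      refine contMDiff_into_localHomeomorph hf continuous_mul ?_
      have := ((l.contDiff (n := ω)).comp (contDiff_mul_entries n)).contMDiff.comp
        ((hι.comp contMDiff_fst).prodMk_space (hι.comp contMDiff_snd))
      exact this
    have hinv : ContMDiff 𝓘(ℂ, Fin d → ℂ) 𝓘(ℂ, Fin d → ℂ) ω fun A : G => A⁻¹ := by
      refine contMDiff_into_localHomeomorph hf continuous_inv ?_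
      have := ((l.contDiff (n := ω)).comp (contDiff_adjugate_entries n)).contMDiff.comp hι
      exact this
    exact { hM with contMDiff_mul := hmul, contMDiff_inv := hinv }
  -- The chart map `f` is `l` after the inclusion; its derivative is injective, hence so is that of
  -- the inclusion.
  · have h1 := injective_mfderiv_localHomeomorph hf A
    have h2 : mfderiv 𝓘(ℂ, Fin d → ℂ) 𝓘(ℂ, Fin d → ℂ) f A = _ :=
      mfderiv_comp A (g := l) l.mdifferentiableAt ((hι A).mdifferentiableAt (by simp))
    rw [h2, ContinuousLinearMap.coe_comp] at h1
    exact h1.of_comp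

/-! ### Tangent vectors at the identity -/

/-- A holomorphic curve of matrices through the identity at time `0` with velocity `Y`, which near
time `0` lies in `G`. -/
structure IsCurveIn {n : ℕ} (G : Subgroup (SpecialLinearGroup (Fin n) ℂ))
    (γ : ℂ → Fin n → Fin n → ℂ) (Y : Fin n → Fin n → ℂ) : Prop where
  hasDerivAt : HasDerivAt γ Y 0
  zero : γ 0 = (1 : Matrix (Fin n) (Fin n) ℂ)
  mem : ∀ᶠ t in 𝓝 0, ∃ A : G, matrixInclusion G A = γ t

theorem matrixInclusion_one {n : ℕ} (G : Subgroup (SpecialLinearGroup (Fin n) ℂ)) :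
    matrixInclusion G 1 = (1 : Matrix (Fin n) (Fin n) ℂ) := rfl

/-- The chart line through the identity gives `ψ`, and the immersion property gives `X ≠ 0`. Any
other curve in the group is locally `ψ ∘ s` for a scalar function `s`, so the chain rule makes its
velocity a multiple of `X`. -/
theorem exists_isCurveIn_spanning {n : ℕ} {G : Subgroup (SpecialLinearGroup (Fin n) ℂ)}
    (h : IsLieSubgroupOfDim G 1) : ∃ ψ X, IsCurveIn G ψ X ∧ X ≠ 0 ∧
      ∀ γ Y, IsCurveIn G γ Y → ∃ c : ℂ, Y = c • X := by
  obtain ⟨cs, -, hι, himm⟩ := h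
  set e := chartAt (Fin 1 → ℂ) (1 : G) with he
  set z₀ := e 1 with hz₀
  set g : (Fin 1 → ℂ) → Fin n → Fin n → ℂ := matrixInclusion G ∘ e.symm with hg
  have hgs : ContDiffAt ℂ ω g z₀ := by
    have := (contMDiffAt_iff.1 (hι 1)).2
    rw [ModelWithCorners.range_eq_univ, contDiffWithinAt_univ] at this
    exact this
  have hstr := hgs.hasStrictFDerivAt (by simp)
  have hinj : Function.Injective (fderiv ℂ g z₀) := by
    have h1 := himm 1
    rw [((hι 1).mdifferentiableAt (by simp)).mfderiv,
      ModelWithCorners.range_eq_univ, fderivWithin_univ] at h1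
    exact h1
  set o : Fin 1 → ℂ := fun _ => 1 with ho
  set X := fderiv ℂ g z₀ o with hX
  have hX0 : X ≠ 0 := by
    intro h0
    have : o = 0 := hinj (by rw [← hX, h0, map_zero])
    simpa [ho] using congrFun this 0
  set ψ : ℂ → Fin n → Fin n → ℂ := fun t => g (z₀ + t • o) with hψ
  have hψd : HasStrictDerivAt ψ X 0 := by
    have h1 : HasStrictDerivAt (fun t : ℂ => z₀ + t • o) o 0 := by
      simpa using ((hasStrictDerivAt_id (0 : ℂ)).smul_const o).const_add z₀
    exact HasStrictFDerivAt.comp_hasStrictDerivAt (l := g) (0 : ℂ) (by simpa using hstr) h1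
  have h1src : (1 : G) ∈ e.source := mem_chart_source _ _
  have hz₀t : z₀ ∈ e.target := e.map_source h1src
  have hψ0 : ψ 0 = (1 : Matrix (Fin n) (Fin n) ℂ) := by
    simp only [hψ, zero_smul, add_zero, hg, Function.comp_apply, hz₀, e.left_inv h1src]
    rfl
  refine ⟨ψ, X, ⟨hψd.hasDerivAt, hψ0, .of_forall fun t => ⟨_, rfl⟩⟩, hX0, ?_⟩
  rintro γ Y ⟨hγ, hγ0, hγm⟩
  -- Lift the matrix curve to the group. The lift tends to the identity because the group has the
  -- topology induced by its matrices, so it eventually enters the chart.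
  obtain ⟨A, hA⟩ := hγm.choice
  have hAt : Tendsto A (𝓝 0) (𝓝 1) := by
    rw [(isInducing_matrixInclusion G).tendsto_nhds_iff, matrixInclusion_one, ← hγ0]
    exact hγ.continuousAt.congr' (hA.mono fun t ht => ht.symm)
  set s : ℂ → ℂ := fun t => e (A t) 0 - z₀ 0 with hs
  have hst : Tendsto s (𝓝 0) (𝓝 0) := by
    have h1 := ((continuous_apply (0 : Fin 1)).tendsto _).comp ((e.continuousAt h1src).tendsto.comp hAt)
    have h2 := h1.sub_const (z₀ 0)
    rwa [← hz₀, sub_self] at h2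
  have hψs : ∀ᶠ t in 𝓝 0, ψ (s t) = γ t := by
    filter_upwards [hA, hAt.eventually (e.open_source.mem_nhds h1src)] with t h1 h2
    have h3 : z₀ + s t • o = e (A t) := by
      ext i
      simp [hs, ho, Fin.fin_one_eq_zero i]
    simp only [hψ, h3, hg, Function.comp_apply]
    rw [e.left_inv h2, h1]
  -- Differentiability of `s` is not known beforehand. An entry with `X i j ≠ 0` makes `t ↦ ψ t i j`
  -- locally invertible, and `s` is its inverse applied to `γ t i j`.
  obtain ⟨i, hi⟩ := Function.ne_iff.1 hX0
  obtain ⟨j, hj⟩ := Function.ne_iff.1 hi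
  have hφ : HasStrictDerivAt (fun t => ψ t i j) (X i j) 0 :=
    hasStrictDerivAt_pi.1 (hasStrictDerivAt_pi.1 hψd i) j
  have hj' : X i j ≠ 0 := hj
  set inv := hφ.localInverse _ _ _ hj' with hinv
  have hinvd : HasDerivAt inv (X i j)⁻¹ (γ 0 i j) := by
    have := (hφ.to_localInverse hj').hasDerivAt
    rwa [hψ0, ← hγ0] at this
  have hleft : ∀ᶠ t in 𝓝 0, inv (ψ t i j) = t := 
    HasStrictFDerivAt.eventually_left_inverse (hφ.hasStrictFDerivAt_equiv hj')
  have hγij : HasDerivAt (fun t => γ t i j) (Y i j) 0 :=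
    hasDerivAt_pi.1 (hasDerivAt_pi.1 hγ i) j
  have hsd : HasDerivAt s ((X i j)⁻¹ * Y i j) 0 := by
    refine (HasDerivAt.comp (0 : ℂ) hinvd hγij).congr_of_eventuallyEq ?_
    filter_upwards [hst.eventually hleft, hψs] with t h1 h2
    rw [Function.comp_apply, ← h2, h1]
  have hA0 : A 0 = 1 := matrixInclusion_injective G (by
    rw [hA.self_of_nhds, hγ0, matrixInclusion_one])
  have hs0 : s 0 = 0 := by simp [hs, hA0, hz₀]
  have hcomp : HasDerivAt (ψ ∘ s) (((X i j)⁻¹ * Y i j) • X) 0 :=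
    HasDerivAt.scomp (0 : ℂ) (by rw [hs0]; exact hψd.hasDerivAt) hsd
  exact ⟨_, hγ.unique (hcomp.congr_of_eventuallyEq (hψs.mono fun t ht => ht.symm))⟩

theorem velocities_dependent {n : ℕ} {G : Subgroup (SpecialLinearGroup (Fin n) ℂ)}
    (h : IsLieSubgroupOfDim G 1) {γ₁ γ₂ : ℂ → Fin n → Fin n → ℂ} {Y₁ Y₂ : Fin n → Fin n → ℂ}
    (h₁ : IsCurveIn G γ₁ Y₁) (h₂ : IsCurveIn G γ₂ Y₂) :
    ∃ c₁ c₂ : ℂ, (c₁ ≠ 0 ∨ c₂ ≠ 0) ∧ ∀ i j, c₁ * Y₁ i j + c₂ * Y₂ i j = 0 := by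
  obtain ⟨ψ, X, -, -, hX⟩ := exists_isCurveIn_spanning h
  obtain ⟨a, rfl⟩ := hX _ _ h₁
  obtain ⟨b, rfl⟩ := hX _ _ h₂
  by_cases ha : a = 0
  · exact ⟨1, 0, .inl one_ne_zero, by simp [ha]⟩
  · refine ⟨b, -a, .inr (by simpa), fun i j => ?_⟩
    simp only [Pi.smul_apply, smul_eq_mul]
    ring

/-! ### Infinitesimal symmetries as derivations -/

/-- The action of the matrix `X` on polynomials by the derivation `x ↦ X x`. -/
noncomputable def lieDerivation {n : ℕ} (X : Matrix (Fin n) (Fin n) ℂ) :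
    Derivation ℂ (MvPolynomial (Fin n) ℂ) (MvPolynomial (Fin n) ℂ) :=
  mkDerivation ℂ fun i => linearForm (X i)

theorem lieDerivation_X {n : ℕ} (X : Matrix (Fin n) (Fin n) ℂ) (i : Fin n) :
    lieDerivation X (MvPolynomial.X i) = linearForm (X i) :=
  mkDerivation_X _ _ _

/-- The derivative in the constant direction `v`. -/
noncomputable def directionalDerivation {n : ℕ} (v : Fin n → ℂ) :
    Derivation ℂ (MvPolynomial (Fin n) ℂ) (MvPolynomial (Fin n) ℂ) :=
  mkDerivation ℂ fun i => C (v i)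

/-- A rank-one matrix sends `x` to `(m ⬝ᵥ x) v`. Hence, if it annihilates `F` and `m ≠ 0`, the
factor `linearForm m` cancels and `F` is constant in the direction `v`. -/
theorem lieDerivation_vecMulVec {n : ℕ} (v m : Fin n → ℂ) :
    lieDerivation (vecMulVec v m) = linearForm m • directionalDerivation v := by
  refine derivation_ext fun i => ?_
  have : vecMulVec v m i = v i • m := by ext; simp [vecMulVec_apply]
  simp [lieDerivation_X, this, linearForm_smul, directionalDerivation, mkDerivation_X, mul_comm]

theorem hasDerivAt_eval_curve {n : ℕ} {ψ : ℂ → Fin n → Fin n → ℂ} {X : Fin n → Fin n → ℂ}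
    (hψ : HasDerivAt ψ X 0) (h0 : ψ 0 = (1 : Matrix (Fin n) (Fin n) ℂ))
    (F : MvPolynomial (Fin n) ℂ) (x : Fin n → ℂ) :
    HasDerivAt (fun t => eval (Matrix.of (ψ t) *ᵥ x) F) (eval x (lieDerivation (of X) F)) 0 := by
  induction F using MvPolynomial.induction_on with
  | C a => simpa [derivation_C] using hasDerivAt_const (0 : ℂ) a
  | add p q hp hq => simpa using hp.fun_add hq
  | mul_X p i hp =>
    have hX : HasDerivAt (fun t => (Matrix.of (ψ t) *ᵥ x) i) (X i ⬝ᵥ x) 0 := by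
      simp only [mulVec, dotProduct, of_apply]
      exact HasDerivAt.fun_sum fun j _ =>
        (hasDerivAt_pi.1 (hasDerivAt_pi.1 hψ i) j).mul_const (x j)
    have := hp.mul hX
    rw [h0] at this
    simp only [Derivation.leibniz, lieDerivation_X, map_add, smul_eq_mul, map_mul, eval_X,
      eval_linearForm]
    convert! this using 1
    · have h1 : (of (1 : Matrix (Fin n) (Fin n) ℂ)) *ᵥ x = x := one_mulVec x
      rw [h1, add_comm, mul_comm (x i)]
      rfl

theorem hasDerivAt_eval_line {n : ℕ} (v x : Fin n → ℂ) (F : MvPolynomial (Fin n) ℂ) (t : ℂ) :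
    HasDerivAt (fun t : ℂ => eval (x + t • v) F)
      (eval (x + t • v) (directionalDerivation v F)) t := by
  induction F using MvPolynomial.induction_on with
  | C a => simpa [derivation_C] using hasDerivAt_const t a
  | add p q hp hq => simpa using hp.fun_add hq
  | mul_X p i hp =>
    have hX : HasDerivAt (fun t : ℂ => (x + t • v) i) (v i) t := by
      simpa using ((hasDerivAt_id t).mul_const (v i)).const_add (x i)
    have := hp.mul hX
    simp only [Derivation.leibniz, directionalDerivation, mkDerivation_X, map_add, smul_eq_mul,
      map_mul, eval_X, eval_C] at this ⊢
    convert! this using 1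
    ring

theorem eval_add_smul_of_directionalDerivation_eq_zero {n : ℕ} {v : Fin n → ℂ}
    {F : MvPolynomial (Fin n) ℂ} (h : directionalDerivation v F = 0) (x : Fin n → ℂ) (t : ℂ) :
    eval (x + t • v) F = eval x F := by
  have hd : ∀ t, HasDerivAt (fun t : ℂ => eval (x + t • v) F) 0 t := fun t => by
    simpa [h] using hasDerivAt_eval_line v x F t
  simpa using is_const_of_deriv_eq_zero (fun t => (hd t).differentiableAt)
    (fun t => (hd t).deriv) t 0

theorem lieDerivation_eq_zero_of_isCurveIn {n : ℕ} {F : MvPolynomial (Fin n) ℂ}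
    {ψ : ℂ → Fin n → Fin n → ℂ} {X : Fin n → Fin n → ℂ}
    (h : IsCurveIn (symmetryGroupSL F) ψ X) : lieDerivation (of X) F = 0 := by
  refine MvPolynomial.funext fun x => ?_
  rw [map_zero]
  refine (hasDerivAt_eval_curve h.hasDerivAt h.zero F x).unique ?_
  refine (hasDerivAt_const (0 : ℂ) (eval x F)).congr_of_eventuallyEq ?_
  filter_upwards [h.mem] with t ⟨A, hA⟩
  rw [← hA]
  exact A.2 x

theorem trace_eq_zero_of_isCurveIn {G : Subgroup (SpecialLinearGroup (Fin 3) ℂ)}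
    {ψ : ℂ → Fin 3 → Fin 3 → ℂ} {X : Fin 3 → Fin 3 → ℂ}
    (h : IsCurveIn G ψ X) : X 0 0 + X 1 1 + X 2 2 = 0 := by
  have hd : ∀ i j, HasDerivAt (fun t => ψ t i j) (X i j) 0 := fun i j =>
    hasDerivAt_pi.1 (hasDerivAt_pi.1 h.hasDerivAt i) j
  have h1 : HasDerivAt (fun t => (of (ψ t)).det) (X 0 0 + X 1 1 + X 2 2) 0 := by
    simp only [det_fin_three, of_apply]
    have := ((((((((hd 0 0).mul (hd 1 1)).mul (hd 2 2)).sub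
      (((hd 0 0).mul (hd 1 2)).mul (hd 2 1))).sub (((hd 0 1).mul (hd 1 0)).mul (hd 2 2))).add
      (((hd 0 1).mul (hd 1 2)).mul (hd 2 0))).add (((hd 0 2).mul (hd 1 0)).mul (hd 2 1))).sub
      (((hd 0 2).mul (hd 1 1)).mul (hd 2 0)))
    convert! this using 1
    simp [h.zero]
  refine h1.unique ((hasDerivAt_const (0 : ℂ) (1 : ℂ)).congr_of_eventuallyEq ?_)
  filter_upwards [h.mem] with t ⟨A, hA⟩
  rw [← hA]
  exact (A : SpecialLinearGroup (Fin 3) ℂ).2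

/-- Since `P` carries the vector field of `X` to that of `T`, an infinitesimal symmetry can be
studied in coordinates where its matrix is triangular. -/
theorem lieDerivation_linSubst {n : ℕ} {P T X : Matrix (Fin n) (Fin n) ℂ} (h : P * X = T * P)
    (F : MvPolynomial (Fin n) ℂ) :
    lieDerivation X (linSubst P F) = linSubst P (lieDerivation T F) := by
  have hl : ∀ u, lieDerivation X (linearForm u) = linearForm (u ᵥ* X) := by
    intro u
    have h1 : lieDerivation X (linearForm u) = ∑ i, C (u i) * linearForm (X i) := by
      rw [linearForm, map_sum]
      simp [derivation_C, lieDerivation_X]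
    refine MvPolynomial.funext fun x => ?_
    rw [h1, eval_linearForm, ← dotProduct_mulVec, map_sum]
    simp only [map_mul, eval_C, eval_linearForm]
    rfl
  induction F using MvPolynomial.induction_on with
  | C a => simp [derivation_C]
  | add p q hp hq => simp [hp, hq]
  | mul_X p i hp =>
    have h1 : P i ᵥ* X = T i ᵥ* P := congrFun h i
    simp [hp, linSubst_X, hl, lieDerivation_X, linSubst_linearForm, h1]

/-! ### Triangular form of a matrix -/

theorem exists_left_eigenvector {n : ℕ} [NeZero n] (X : Matrix (Fin n) (Fin n) ℂ) :
    ∃ (u : Fin n → ℂ) (c : ℂ), u ≠ 0 ∧ u ᵥ* X = c • u := by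
  have : Nontrivial (Fin n → ℂ) := Function.nontrivial
  obtain ⟨c, hc⟩ := Module.End.exists_eigenvalue (Matrix.toLin' Xᵀ)
  obtain ⟨u, hu⟩ := hc.exists_hasEigenvector
  refine ⟨u, c, hu.2, ?_⟩
  have := hu.apply_eq_smul
  rwa [toLin'_apply, mulVec_transpose] at this

/-- Every matrix is similar to a lower triangular one. -/
theorem exists_lowerTriangular (X : Matrix (Fin 3) (Fin 3) ℂ) :
    ∃ P T : Matrix (Fin 3) (Fin 3) ℂ, P.det ≠ 0 ∧ P * X = T * P ∧
      T 0 1 = 0 ∧ T 0 2 = 0 ∧ T 1 2 = 0 := by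
  obtain ⟨u, c, hu, huX⟩ := exists_left_eigenvector X
  obtain ⟨P, hP, rfl⟩ := exists_det_ne_zero_row_eq hu 0
  have hPu : IsUnit P.det := isUnit_iff_ne_zero.2 hP
  set T := P * X * P⁻¹ with hT
  have hPX : P * X = T * P := by rw [hT, nonsing_inv_mul_cancel_right _ _ hPu]
  have hT0 : T 0 = Pi.single 0 c := by
    have h1 : T 0 = (P 0 ᵥ* X) ᵥ* P⁻¹ := by rw [hT]; rfl
    have h2 : P 0 ᵥ* P⁻¹ = (1 : Matrix (Fin 3) (Fin 3) ℂ) 0 := by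
      rw [← mul_nonsing_inv P hPu]; rfl
    rw [h1, huX, smul_vecMul, h2]
    ext i; fin_cases i <;> simp
  -- Row 0 of `T` is already diagonal, so a left eigenvector of the lower right block finishes the
  -- triangularization.
  obtain ⟨w, d, hw, hwB⟩ := exists_left_eigenvector (T.submatrix Fin.succ Fin.succ)
  obtain ⟨R, hR, rfl⟩ := exists_det_ne_zero_row_eq hw 0
  set S : Matrix (Fin 3) (Fin 3) ℂ := !![1, 0, 0; 0, R 0 0, R 0 1; 0, R 1 0, R 1 1] with hS
  have hSd : S.det ≠ 0 := by
    rw [det_fin_two] at hR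
    simpa [hS, det_fin_three] using hR
  have hSu : IsUnit S.det := isUnit_iff_ne_zero.2 hSd
  set T' := S * T * S⁻¹ with hT'
  have hST : S * T = T' * S := by rw [hT', nonsing_inv_mul_cancel_right _ _ hSu]
  have hrow : ∀ i, S i ᵥ* S⁻¹ = (1 : Matrix (Fin 3) (Fin 3) ℂ) i := fun i => by
    rw [← mul_nonsing_inv S hSu]; rfl
  have hT0' : T' 0 = c • (1 : Matrix (Fin 3) (Fin 3) ℂ) 0 := by
    have h1 : T' 0 = (S 0 ᵥ* T) ᵥ* S⁻¹ := by rw [hT']; rfl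
    have h2 : S 0 ᵥ* T = c • S 0 := by
      ext i; fin_cases i <;> simp [hS, vecMul, dotProduct, Fin.sum_univ_three, hT0]
    rw [h1, h2, smul_vecMul, hrow]
  have hT1' : ∃ a : ℂ, T' 1 = a • (1 : Matrix (Fin 3) (Fin 3) ℂ) 0 +
      d • (1 : Matrix (Fin 3) (Fin 3) ℂ) 1 := by
    refine ⟨R 0 0 * T 1 0 + R 0 1 * T 2 0, ?_⟩
    have h1 : T' 1 = (S 1 ᵥ* T) ᵥ* S⁻¹ := by rw [hT']; rfl
    have h2 : S 1 ᵥ* T = (R 0 0 * T 1 0 + R 0 1 * T 2 0) • S 0 + d • S 1 := by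
      have e0 := congrFun hwB 0
      have e1 := congrFun hwB 1
      simp only [vecMul, dotProduct, Fin.sum_univ_two, submatrix_apply, Pi.smul_apply,
        smul_eq_mul] at e0 e1
      ext i; fin_cases i
      · simp [hS, vecMul, dotProduct, Fin.sum_univ_three]
      · simpa [hS, vecMul, dotProduct, Fin.sum_univ_three] using e0
      · simpa [hS, vecMul, dotProduct, Fin.sum_univ_three] using e1
    rw [h1, h2, add_vecMul, smul_vecMul, smul_vecMul, hrow, hrow]
  obtain ⟨a, hT1'⟩ := hT1'
  refine ⟨S * P, T', by rw [det_mul]; exact mul_ne_zero hSd hP, ?_, ?_, ?_, ?_⟩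
  · rw [Matrix.mul_assoc, hPX, ← Matrix.mul_assoc, hST, Matrix.mul_assoc]
  · simp [hT0']
  · simp [hT0']
  · simp [hT1']

/-- A lower triangular matrix whose nonzero entries off the diagonal only link equal diagonal
entries. -/
def IsSplitTriangular (T : Matrix (Fin 3) (Fin 3) ℂ) : Prop :=
  T 0 1 = 0 ∧ T 0 2 = 0 ∧ T 1 2 = 0 ∧ T 1 0 * (T 0 0 - T 1 1) = 0 ∧
    T 2 0 * (T 0 0 - T 2 2) = 0 ∧ T 2 1 * (T 1 1 - T 2 2) = 0

theorem exists_mul_sub_add_eq_zero (a x y : ℂ) : ∃ s, (a + s * (x - y)) * (x - y) = 0 := by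
  by_cases h : x - y = 0
  · exact ⟨0, by rw [h, mul_zero]⟩
  · exact ⟨-a / (x - y), by rw [div_mul_cancel₀ _ h]; simp⟩

theorem exists_isSplitTriangular (X : Matrix (Fin 3) (Fin 3) ℂ) :
    ∃ P T : Matrix (Fin 3) (Fin 3) ℂ, P.det ≠ 0 ∧ P * X = T * P ∧ IsSplitTriangular T := by
  obtain ⟨P, T, hP, hPX, h01, h02, h12⟩ := exists_lowerTriangular X
  -- Conjugation by a lower unipotent matrix removes each entry between distinct eigenvalues. The
  -- choice of `r` comes last, since `s` and `t` also change the entry at `(2, 0)`.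
  obtain ⟨s, hs⟩ := exists_mul_sub_add_eq_zero (T 1 0) (T 0 0) (T 1 1)
  obtain ⟨t, ht⟩ := exists_mul_sub_add_eq_zero (T 2 1) (T 1 1) (T 2 2)
  obtain ⟨r, hr⟩ := exists_mul_sub_add_eq_zero
    (T 2 0 - T 2 1 * s + t * (T 1 0 + s * (T 0 0 - T 1 1))) (T 0 0) (T 2 2)
  set S : Matrix (Fin 3) (Fin 3) ℂ := !![1, 0, 0; s, 1, 0; r + t * s, t, 1] with hS
  set T' : Matrix (Fin 3) (Fin 3) ℂ := !![T 0 0, 0, 0;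
    T 1 0 + s * (T 0 0 - T 1 1), T 1 1, 0;
    T 2 0 - T 2 1 * s + t * (T 1 0 + s * (T 0 0 - T 1 1)) + r * (T 0 0 - T 2 2),
      T 2 1 + t * (T 1 1 - T 2 2), T 2 2] with hT'
  have hST : S * T = T' * S := by
    ext i j
    fin_cases i <;> fin_cases j <;>
      simp [hS, hT', Matrix.mul_apply, Fin.sum_univ_three, h01, h02, h12] <;> ring
  refine ⟨S * P, T', ?_, ?_, ?_⟩
  · rw [det_mul]
    refine mul_ne_zero ?_ hP
    simp [hS, det_fin_three]
  · rw [Matrix.mul_assoc, hPX, ← Matrix.mul_assoc, hST, Matrix.mul_assoc]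
  · refine ⟨by simp [hT'], by simp [hT'], by simp [hT'], ?_, ?_, ?_⟩
    · simpa [hT'] using hs
    · simpa [hT'] using hr
    · simpa [hT'] using ht

/-! ### Coefficient equations for an annihilated cubic -/

theorem coeffs_eq_zero_of_cubic_eq_zero {a b c d e f g h k l : ℂ}
    (H : ∀ x y z : ℂ, a * x ^ 3 + b * (x ^ 2 * y) + c * (x ^ 2 * z) + d * (x * y ^ 2) +
      e * (x * y * z) + f * (x * z ^ 2) + g * y ^ 3 + h * (y ^ 2 * z) + k * (y * z ^ 2) +
      l * z ^ 3 = 0) :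
    a = 0 ∧ b = 0 ∧ c = 0 ∧ d = 0 ∧ e = 0 ∧ f = 0 ∧ g = 0 ∧ h = 0 ∧ k = 0 ∧ l = 0 := by
  have h1 := H 1 0 0
  have h2 := H 0 1 0
  have h3 := H 0 0 1
  have h4 := H 1 1 0
  have h5 := H 1 (-1) 0
  have h6 := H 1 0 1
  have h7 := H 1 0 (-1)
  have h8 := H 0 1 1
  have h9 := H 0 1 (-1)
  have h10 := H 1 1 1
  ring_nf at h1 h2 h3 h4 h5 h6 h7 h8 h9 h10
  subst h1 h2 h3
  refine ⟨rfl, ?_, ?_, ?_, ?_, ?_, rfl, ?_, ?_, rfl⟩ <;> grind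

/-- The equations for the coefficients of a cubic form annihilated by the derivation of a lower
triangular matrix, by descending induction along the monomials. -/
theorem monomials_weight_zero {p q r α β γ a b c d f g h k l : ℂ}
    (hα : α * (p - q) = 0) (hβ : β * (p - r) = 0) (hγ : γ * (q - r) = 0) (ht : p + q + r = 0)
    (hne : p ≠ 0 ∨ q ≠ 0 ∨ r ≠ 0) {e : ℂ}
    (e1 : 3 * p * a + α * b + β * c = 0)
    (e2 : (2 * p + q) * b + 2 * α * d + γ * c + β * e = 0)
    (e3 : (2 * p + r) * c + α * e + 2 * β * f = 0)
    (e4 : (p + 2 * q) * d + 3 * α * g + γ * e + β * h = 0)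
    (e6 : (p + 2 * r) * f + α * k + 3 * β * l = 0)
    (e7 : 3 * q * g + γ * h = 0)
    (e8 : (2 * q + r) * h + 2 * γ * k = 0)
    (e9 : (q + 2 * r) * k + 3 * γ * l = 0)
    (e10 : 3 * r * l = 0) :
    (g = 0 ∧ h = 0 ∧ k = 0 ∧ l = 0) ∨ (a = 0 ∧ c = 0 ∧ f = 0 ∧ l = 0) ∨
      (a = 0 ∧ b = 0 ∧ d = 0 ∧ g = 0) := by
  obtain rfl : r = -p - q := by linear_combination ht
  -- For two equal eigenvalues, the cubic monomials in the two corresponding variables all have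
  -- weight three times that eigenvalue. It is nonzero, for otherwise the trace condition would make
  -- all three vanish. So these monomials disappear and the third variable divides the form.
  by_cases hpq : p = q
  · subst hpq
    have hp : p ≠ 0 := by rintro rfl; simp at hne
    have h1 : β = 0 := by grind
    have h2 : γ = 0 := by grind
    subst h1 h2
    right; right
    have : g = 0 := by grind
    have : d = 0 := by grind
    have : b = 0 := by grind
    grind
  by_cases hqr : q = -p - q
  · have hq : q ≠ 0 := by grind
    have h1 : β = 0 := by grind
    have h2 : α = 0 := by grind
    subst h1 h2
    left
    have : l = 0 := by grind
    have : k = 0 := by grind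
    have : h = 0 := by grind
    grind
  by_cases hpr : p = -p - q
  · have hp : p ≠ 0 := by grind
    have h1 : γ = 0 := by grind
    have h2 : α = 0 := by grind
    subst h1 h2
    right; left
    have : l = 0 := by grind
    have : f = 0 := by grind
    have : c = 0 := by grind
    grind
  -- With distinct eigenvalues the matrix is diagonal. A monomial in exactly two variables has as
  -- weight a difference of eigenvalues, for example `2p + q = p - r`, so it disappears. At most one
  -- eigenvalue is zero, so at most one cube survives, beside the product of the three variables.
  have h1 : α = 0 := by grind
  have h2 : β = 0 := by grind
  have h3 : γ = 0 := by grind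
  subst h1 h2 h3
  simp only [zero_mul, mul_zero, add_zero, mul_eq_zero] at e1 e2 e3 e4 e6 e7 e8 e9 e10
  clear hα hβ hγ ht
  grind

/-! ### Cones and triangles have too many symmetries -/

theorem isCurveIn_transvection {F : MvPolynomial (Fin 3) ℂ} {v m : Fin 3 → ℂ}
    (h : ∀ (x : Fin 3 → ℂ) (t : ℂ), eval (x + t • v) F = eval x F) (hm : m ⬝ᵥ v = 0) :
    IsCurveIn (symmetryGroupSL F)
      (fun t i j => (1 : Matrix (Fin 3) (Fin 3) ℂ) i j + t * (v i * m j))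
      (fun i j => v i * m j) where
  hasDerivAt := by
    refine hasDerivAt_pi.2 fun i => hasDerivAt_pi.2 fun j => ?_
    simpa using ((hasDerivAt_id (0 : ℂ)).mul_const (v i * m j)).const_add
      ((1 : Matrix (Fin 3) (Fin 3) ℂ) i j)
  zero := by ext; simp
  mem := .of_forall fun t => by
    have hdet : (1 + t • vecMulVec v m).det = 1 := by
      simp only [dotProduct, Fin.sum_univ_three] at hm
      simp [det_fin_three, vecMulVec_apply]
      linear_combination t * hm
    refine ⟨⟨⟨1 + t • vecMulVec v m, hdet⟩, fun x => ?_⟩, ?_⟩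
    · have : (1 + t • vecMulVec v m) *ᵥ x = x + (t * (m ⬝ᵥ x)) • v := by
        rw [add_mulVec, one_mulVec, smul_mulVec, vecMulVec_mulVec]
        ext i
        simp
        ring
      exact this ▸ h x _
    · ext i j
      simp [matrixInclusion, vecMulVec_apply]

/-- A cubic cone has a symmetry group of dimension greater than one. -/
theorem not_isLieSubgroupOfDim_one_of_cone {F : MvPolynomial (Fin 3) ℂ} {v : Fin 3 → ℂ}
    (hv : v ≠ 0) (h : ∀ (x : Fin 3 → ℂ) (t : ℂ), eval (x + t • v) F = eval x F) :
    ¬ IsLieSubgroupOfDim (symmetryGroupSL F) 1 := by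
  intro hL
  obtain ⟨p, hp⟩ := Function.ne_iff.1 hv
  have hp : v p ≠ 0 := hp
  obtain ⟨q, r, hqp, hrp, hqr⟩ : ∃ q r : Fin 3, q ≠ p ∧ r ≠ p ∧ q ≠ r :=
    (by decide : ∀ p : Fin 3, ∃ q r : Fin 3, q ≠ p ∧ r ≠ p ∧ q ≠ r) p
  -- Two independent covectors vanishing on `v`. The entries `(p, q)` and `(p, r)` separate the two
  -- velocities because `v p ≠ 0`.
  obtain ⟨c₁, c₂, hc, H⟩ := velocities_dependent hL
    (isCurveIn_transvection (m := Pi.single q (v p) - Pi.single p (v q)) h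
      (by simp [sub_dotProduct, mul_comm]))
    (isCurveIn_transvection (m := Pi.single r (v p) - Pi.single p (v r)) h
      (by simp [sub_dotProduct, mul_comm]))
  have h1 := H p q
  have h2 := H p r
  simp [hqp, hrp, hqr, hqr.symm, hp] at h1 h2
  tauto

theorem mul_mul_inv_mul_mul_mul_inv {n : ℕ} {P : Matrix (Fin n) (Fin n) ℂ} (hP : P.det ≠ 0)
    (D : Matrix (Fin n) (Fin n) ℂ) : P * (P⁻¹ * D * P) = D * P := by
  rw [Matrix.mul_assoc, mul_nonsing_inv_cancel_left _ _ (isUnit_iff_ne_zero.2 hP)]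

theorem isCurveIn_conj_diagonal {F : MvPolynomial (Fin 3) ℂ} {P : Matrix (Fin 3) (Fin 3) ℂ}
    (hP : P.det ≠ 0) (hF : F = linSubst P (X 0 * X 1 * X 2)) {a : Fin 3 → ℂ}
    (ha : a 0 + a 1 + a 2 = 0) :
    IsCurveIn (symmetryGroupSL F)
      (fun t => P⁻¹ * diagonal (fun i => Complex.exp (t * a i)) * P)
      (P⁻¹ * diagonal a * P) where
  hasDerivAt := by
    refine hasDerivAt_pi.2 fun i => hasDerivAt_pi.2 fun j => ?_
    simp only [Matrix.mul_apply, diagonal_apply]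
    refine HasDerivAt.fun_sum fun k _ => HasDerivAt.mul_const ?_ _
    refine HasDerivAt.fun_sum fun l _ => HasDerivAt.const_mul _ ?_
    split_ifs with h
    · have := ((hasDerivAt_id (0 : ℂ)).mul_const (a l)).cexp
      simpa using this
    · exact hasDerivAt_const _ _
  zero := by
    simp only [zero_mul, Complex.exp_zero, diagonal_one, Matrix.mul_one,
      nonsing_inv_mul _ (isUnit_iff_ne_zero.2 hP)]
    rfl
  mem := .of_forall fun t => by
    have hexp : Complex.exp (t * a 0) * Complex.exp (t * a 1) * Complex.exp (t * a 2) = 1 := by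
      rw [← Complex.exp_add, ← Complex.exp_add, ← mul_add, ← mul_add, ha, mul_zero,
        Complex.exp_zero]
    have hdet : (P⁻¹ * diagonal (fun i => Complex.exp (t * a i)) * P).det = 1 := by
      rw [det_mul, det_mul, mul_right_comm, det_nonsing_inv, Ring.inverse_mul_cancel _
        (isUnit_iff_ne_zero.2 hP), one_mul, det_diagonal, Fin.prod_univ_three, hexp]
    refine ⟨⟨⟨_, hdet⟩, mem_symmetryGroupSL_iff.2 ?_⟩, rfl⟩
    simp only [hF, linSubst_linSubst, mul_mul_inv_mul_mul_mul_inv hP]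
    rw [← linSubst_linSubst]
    refine congrArg _ (MvPolynomial.funext fun x => ?_)
    simp only [eval_linSubst, map_mul, eval_X, mulVec_diagonal]
    linear_combination x 0 * x 1 * x 2 * hexp

/-- The symmetry group of a triangle has dimension greater than one. -/
theorem not_isLieSubgroupOfDim_one_of_triangle {F : MvPolynomial (Fin 3) ℂ}
    {P : Matrix (Fin 3) (Fin 3) ℂ} (hP : P.det ≠ 0) (hF : F = linSubst P (X 0 * X 1 * X 2)) :
    ¬ IsLieSubgroupOfDim (symmetryGroupSL F) 1 := by
  intro hL
  obtain ⟨c₁, c₂, hc, H⟩ := velocities_dependent hL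
    (isCurveIn_conj_diagonal hP hF (a := ![1, -1, 0]) (by simp))
    (isCurveIn_conj_diagonal hP hF (a := ![1, 0, -1]) (by simp))
  have h1 : c₁ • (P⁻¹ * diagonal ![1, -1, 0] * P) + c₂ • (P⁻¹ * diagonal ![1, 0, -1] * P) = 0 := by
    ext i j; exact H i j
  have h2 : c₁ • diagonal ![1, -1, 0] + c₂ • diagonal ![1, 0, (-1 : ℂ)] = 0 := by
    have hu := isUnit_iff_ne_zero.2 hP
    have := congrArg (fun M => P * M * P⁻¹) h1
    simpa [Matrix.mul_add, Matrix.add_mul, mul_mul_inv_mul_mul_mul_inv hP,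
      mul_nonsing_inv_cancel_right _ _ hu] using this
  have h3 := congrFun (congrFun h2 1) 1
  have h4 := congrFun (congrFun h2 2) 2
  simp at h3 h4
  tauto

/-- Dependent linear forms have a common nonzero zero, which is a vertex direction of a cone;
independent ones are coordinates, and the lines form a triangle. -/
theorem not_isLieSubgroupOfDim_one_of_lines {F : MvPolynomial (Fin 3) ℂ} {u v w : Fin 3 → ℂ}
    (hF : F = linearForm u * (linearForm v * linearForm w)) :
    ¬ IsLieSubgroupOfDim (symmetryGroupSL F) 1 := by
  by_cases hP : (of ![u, v, w]).det = 0
  · obtain ⟨x, hx, hPx⟩ := exists_mulVec_eq_zero_iff.2 hP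
    refine not_isLieSubgroupOfDim_one_of_cone hx fun y t => ?_
    have h0 : u ⬝ᵥ x = 0 := congrFun hPx 0
    have h1 : v ⬝ᵥ x = 0 := congrFun hPx 1
    have h2 : w ⬝ᵥ x = 0 := congrFun hPx 2
    simp [hF, eval_linearForm, h0, h1, h2]
  · refine not_isLieSubgroupOfDim_one_of_triangle hP ?_
    simp only [hF, map_mul, linSubst_X, mul_assoc]
    rfl

/-! ### From dimension one to a line and an irreducible conic -/

theorem exists_eq_mul_linearForm_of_not_irreducible {n : ℕ} {Q : MvPolynomial (Fin n) ℂ}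
    (hQ : Q.IsHomogeneous 2) (hQ0 : Q ≠ 0) (h : ¬ Irreducible Q) :
    ∃ u v, Q = linearForm u * linearForm v := by
  have hdeg := hQ.totalDegree hQ0
  have hunit : ∀ p : MvPolynomial (Fin n) ℂ, p ≠ 0 → ¬ IsUnit p → 1 ≤ p.totalDegree := by
    intro p hp hpu
    by_contra hlt
    have hpC := totalDegree_eq_zero_iff_eq_C.1 (show p.totalDegree = 0 by omega)
    rw [hpC] at hp hpu
    exact hpu ((isUnit_iff_ne_zero.2 fun h => hp (by rw [h, map_zero])).map C)
  have hQu : ¬ IsUnit Q := fun hu => by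
    have := (MvPolynomial.isUnit_iff_totalDegree_of_isReduced.1 hu).2
    omega
  simp only [irreducible_iff, hQu, not_false_eq_true, true_and, not_forall, not_or] at h
  obtain ⟨a, b, rfl, ha, hb⟩ := h
  have ha0 : a ≠ 0 := left_ne_zero_of_mul hQ0
  have hb0 : b ≠ 0 := right_ne_zero_of_mul hQ0
  rw [totalDegree_mul_of_isDomain ha0 hb0] at hdeg
  have ha1 := hunit a ha0 ha
  have hb1 := hunit b hb0 hb
  have hsplit : ∀ p : MvPolynomial (Fin n) ℂ, p.totalDegree = 1 →
      ∃ u c, p = linearForm u + C c := by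
    intro p hp
    obtain ⟨u, hu⟩ := exists_eq_linearForm (homogeneousComponent_isHomogeneous 1 p)
    refine ⟨u, coeff 0 p, ?_⟩
    conv_lhs => rw [← sum_homogeneousComponent p, hp]
    simp [Finset.sum_range_succ, hu, homogeneousComponent_zero, add_comm]
  obtain ⟨u, c, rfl⟩ := hsplit a (by omega)
  obtain ⟨v, d, rfl⟩ := hsplit b (by omega)
  refine ⟨u, v, ?_⟩
  -- The factors may carry constants `c` and `d`; taking degree-two components of the product
  -- discards them.
  have huv : (linearForm u * linearForm v).IsHomogeneous 2 :=
    (linearForm_isHomogeneous u).mul (linearForm_isHomogeneous v)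
  have h1 : ((linearForm u + C c) * (linearForm v + C d) : MvPolynomial (Fin n) ℂ) =
      linearForm u * linearForm v + (C d * linearForm u + C c * linearForm v) + C (c * d) := by
    rw [map_mul]; ring
  have hl : (C d * linearForm u + C c * linearForm v).IsHomogeneous 1 :=
    ((linearForm_isHomogeneous u).C_mul d).add ((linearForm_isHomogeneous v).C_mul c)
  rw [← homogeneousComponent_eq_self hQ, h1, map_add, map_add, homogeneousComponent_eq_self huv,
    homogeneousComponent_of_mem hl, homogeneousComponent_of_mem (isHomogeneous_C _ (c * d))]
  simp

theorem isHomogeneous_of_X_mul {n d : ℕ} {i : Fin n} {R : MvPolynomial (Fin n) ℂ}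
    (h : (X i * R).IsHomogeneous (d + 1)) : R.IsHomogeneous d := by
  intro m hm
  rw [← coeff_X_mul m i R] at hm
  have := h hm
  rw [map_add] at this
  simp only [Finsupp.weight_single, Pi.one_apply, smul_eq_mul, mul_one] at this
  omega

theorem splits_of_isLieSubgroupOfDim_one {F : MvPolynomial (Fin 3) ℂ} (hF : F.IsHomogeneous 3)
    (hF0 : F ≠ 0) (hL : IsLieSubgroupOfDim (symmetryGroupSL F) 1) :
    SplitsLinearIrreducibleQuadratic F := by
  obtain ⟨ψ, X₀, hψ, hX0, -⟩ := exists_isCurveIn_spanning hL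
  have htr := trace_eq_zero_of_isCurveIn hψ
  have hD := lieDerivation_eq_zero_of_isCurveIn hψ
  obtain ⟨P, T, hP, hPX, hT⟩ := exists_isSplitTriangular (of X₀)
  have hPu := isUnit_iff_ne_zero.2 hP
  have hTX : T = P * of X₀ * P⁻¹ := by rw [hPX, mul_nonsing_inv_cancel_right _ _ hPu]
  have hXT : of X₀ = P⁻¹ * T * P := by
    rw [Matrix.mul_assoc, ← hPX, nonsing_inv_mul_cancel_left _ _ hPu]
  have hTtr : T 0 0 + T 1 1 + T 2 2 = 0 := by
    have : T.trace = (of X₀).trace := by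
      rw [hTX, trace_mul_comm, nonsing_inv_mul_cancel_left _ _ hPu]
    simpa [trace, Fin.sum_univ_three, htr] using this
  obtain ⟨F', hF'h, hFF'⟩ : ∃ F', F'.IsHomogeneous 3 ∧ F = linSubst P F' :=
    ⟨linSubst P⁻¹ F, linSubst_isHomogeneous hF _, by
      rw [linSubst_linSubst, nonsing_inv_mul _ hPu, linSubst_one]⟩
  have hDF' : lieDerivation T F' = 0 := by
    apply linSubst_injective (mul_nonsing_inv P hPu)
    rw [← lieDerivation_linSubst hPX, ← hFF', hD, map_zero]
  -- A coordinate factor suffices: a reducible cofactor would make `F` a product of three lines.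
  have hsplit : ∀ i, X i ∣ F' → SplitsLinearIrreducibleQuadratic F := by
    rintro i ⟨R, rfl⟩
    have hQ := linSubst_isHomogeneous (isHomogeneous_of_X_mul hF'h) P
    rw [map_mul, linSubst_X] at hFF'
    refine ⟨_, _, linearForm_isHomogeneous (P i), hQ, ?_, hFF'⟩
    by_contra hirr
    obtain ⟨u, v, huv⟩ := exists_eq_mul_linearForm_of_not_irreducible hQ
      (right_ne_zero_of_mul (hFF' ▸ hF0)) hirr
    exact not_isLieSubgroupOfDim_one_of_lines (hFF'.trans (by rw [huv])) hL
  have hcone : ∀ v m : Fin 3 → ℂ, v ≠ 0 → m ≠ 0 → T = vecMulVec v m → False := by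
    intro v m hv hm hTv
    rw [hTv, lieDerivation_vecMulVec, Derivation.smul_apply, smul_eq_mul, mul_eq_zero] at hDF'
    have h1 := hDF'.resolve_left fun h => hm (linearForm_injective (h.trans linearForm_zero.symm))
    refine not_isLieSubgroupOfDim_one_of_cone (v := P⁻¹ *ᵥ v) (F := F) ?_ (fun x t => ?_) hL
    · intro h0
      apply hv
      rw [← one_mulVec v, ← mul_nonsing_inv P hPu, ← mulVec_mulVec, h0, mulVec_zero]
    · rw [hFF', eval_linSubst, eval_linSubst, mulVec_add, mulVec_smul, mulVec_mulVec,
        mul_nonsing_inv P hPu, one_mulVec, eval_add_smul_of_directionalDerivation_eq_zero h1]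
  obtain ⟨h01, h02, h12, h10, h20, h21⟩ := hT
  obtain ⟨a, b, c, d, e, f, g, h, k, l, rfl⟩ := exists_eq_of_isHomogeneous_three hF'h
  -- The ten coefficients of `lieDerivation T F'` for lower triangular `T`.
  obtain ⟨e1, e2, e3, e4, e5, e6, e7, e8, e9, e10⟩ :=
    coeffs_eq_zero_of_cubic_eq_zero
    (a := 3 * T 0 0 * a + T 1 0 * b + T 2 0 * c)
    (b := (2 * T 0 0 + T 1 1) * b + 2 * T 1 0 * d + T 2 1 * c + T 2 0 * e)
    (c := (2 * T 0 0 + T 2 2) * c + T 1 0 * e + 2 * T 2 0 * f)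
    (d := (T 0 0 + 2 * T 1 1) * d + 3 * T 1 0 * g + T 2 1 * e + T 2 0 * h)
    (e := (T 0 0 + T 1 1 + T 2 2) * e + 2 * T 1 0 * h + 2 * T 2 1 * f + 2 * T 2 0 * k)
    (f := (T 0 0 + 2 * T 2 2) * f + T 1 0 * k + 3 * T 2 0 * l)
    (g := 3 * T 1 1 * g + T 2 1 * h)
    (h := (2 * T 1 1 + T 2 2) * h + 2 * T 2 1 * k)
    (k := (T 1 1 + 2 * T 2 2) * k + 3 * T 2 1 * l)
    (l := 3 * T 2 2 * l) (by
      intro x y z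
      have := congrArg (eval ![x, y, z]) hDF'
      simp [Derivation.leibniz, Derivation.leibniz_pow, lieDerivation_X, derivation_C,
        eval_linearForm, dotProduct, Fin.sum_univ_three, h01, h02, h12] at this
      linear_combination this)
  by_cases hne : T 0 0 ≠ 0 ∨ T 1 1 ≠ 0 ∨ T 2 2 ≠ 0
  · rcases monomials_weight_zero h10 h20 h21 hTtr hne e1 e2 e3 e4 e6 e7 e8 e9 e10 with
      ⟨rfl, rfl, rfl, rfl⟩ | ⟨rfl, rfl, rfl, rfl⟩ | ⟨rfl, rfl, rfl, rfl⟩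
    · refine hsplit 0 ⟨C a * X 0 ^ 2 + C b * (X 0 * X 1) + C c * (X 0 * X 2) + C d * X 1 ^ 2 +
        C e * (X 1 * X 2) + C f * X 2 ^ 2, ?_⟩
      simp only [map_zero]; ring
    · refine hsplit 1 ⟨C b * X 0 ^ 2 + C d * (X 0 * X 1) + C e * (X 0 * X 2) + C g * X 1 ^ 2 +
        C h * (X 1 * X 2) + C k * X 2 ^ 2, ?_⟩
      simp only [map_zero]; ring
    · refine hsplit 2 ⟨C c * X 0 ^ 2 + C e * (X 0 * X 1) + C f * (X 0 * X 2) + C h * X 1 ^ 2 +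
        C k * (X 1 * X 2) + C l * X 2 ^ 2, ?_⟩
      simp only [map_zero]; ring
  · push Not at hne
    obtain ⟨h00, h11, h22⟩ := hne
    have hT0 : T ≠ 0 := by
      rintro rfl
      rw [Matrix.mul_zero, Matrix.zero_mul] at hXT
      exact hX0 hXT
    -- The nilpotent case. If `T 1 0 = 0` only the last row of `T` survives, and if `T 2 1 = 0` only
    -- the first column; both have rank one and lead to a cone.
    by_cases hα : T 1 0 = 0
    · refine (hcone (Pi.single 2 1) (T 2) (by simp) (fun h0 => hT0 ?_) ?_).elim
      · ext i j
        fin_cases i <;> fin_cases j <;> simp [h00, h11, h22, h01, h02, h12, hα, h0]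
      · ext i j
        fin_cases i <;> fin_cases j <;> simp [vecMulVec_apply, h00, h11, h22, h01, h02, h12, hα]
    by_cases hγ : T 2 1 = 0
    · refine (hcone (fun i => T i 0) (Pi.single 0 1) (fun h0 => hα (congrFun h0 1)) (by simp)
        ?_).elim
      ext i j
      fin_cases i <;> fin_cases j <;> simp [vecMulVec_apply, h00, h11, h22, h01, h02, h12, hγ]
    -- Nilpotent of rank two: the equations kill `h`, `k`, `l`, then `f`, and finally `e` and `g`,
    -- leaving only multiples of `X 0`.
    · simp only [h11, h22, mul_zero, zero_mul, zero_add, add_zero, mul_eq_zero, hγ,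
        OfNat.ofNat_ne_zero, false_or] at e7 e8 e9
      subst e7 e8 e9
      simp only [h00, h11, h22, mul_zero, zero_mul, zero_add, add_zero, mul_eq_zero, hγ,
        OfNat.ofNat_ne_zero, false_or] at e5
      subst e5
      obtain rfl : g = 0 := by grind
      refine hsplit 0 ⟨C a * X 0 ^ 2 + C b * (X 0 * X 1) + C c * (X 0 * X 2) + C d * X 1 ^ 2 +
        C e * (X 1 * X 2), ?_⟩
      simp only [map_zero]; ring

/-! ### Normal forms of a line with an irreducible conic -/

/-- The quadratic form `Q` is not a product of linear forms. -/
def NotLinePair {n : ℕ} (Q : MvPolynomial (Fin n) ℂ) : Prop :=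
  ∀ u v, Q ≠ linearForm u * linearForm v

theorem not_isUnit_linearForm {n : ℕ} (u : Fin n → ℂ) : ¬ IsUnit (linearForm u) := by
  intro h
  have := h.map (eval (0 : Fin n → ℂ))
  rw [eval_linearForm, dotProduct_zero] at this
  exact not_isUnit_zero this

theorem notLinePair_of_irreducible {n : ℕ} {Q : MvPolynomial (Fin n) ℂ} (hQ : Irreducible Q) :
    NotLinePair Q := fun u v h =>
  (hQ.isUnit_or_isUnit h).elim (not_isUnit_linearForm u) (not_isUnit_linearForm v)

/-- A substitution maps products of linear forms to such products, so this consequence of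
irreducibility is easy to carry through changes of coordinates. -/
theorem NotLinePair.of_linSubst {n : ℕ} {P : Matrix (Fin n) (Fin n) ℂ}
    {Q : MvPolynomial (Fin n) ℂ} (h : NotLinePair (linSubst P Q)) : NotLinePair Q := by
  rintro u v rfl
  exact h _ _ (by rw [map_mul, linSubst_linearForm, linSubst_linearForm])

theorem exists_binary_quadratic_factorization (a b c : ℂ) :
    ∃ p q r s : ℂ, a = p * r ∧ b = p * s + q * r ∧ c = q * s := by
  by_cases ha : a = 0
  · exact ⟨0, 1, b, c, by simp [ha], by simp, by simp⟩
  · obtain ⟨δ, hδ⟩ := IsAlgClosed.exists_pow_nat_eq (b ^ 2 - 4 * a * c) (n := 2) (by norm_num)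
    refine ⟨a, (b - δ) / 2, 1, (b + δ) / (2 * a), by ring, by field_simp; ring, ?_⟩
    field_simp
    linear_combination hδ

theorem exists_binary_quadratic_square {a b c : ℂ} (h : b ^ 2 = 4 * a * c) :
    ∃ α β : ℂ, a = α ^ 2 ∧ b = 2 * α * β ∧ c = β ^ 2 := by
  obtain ⟨α, hα⟩ := IsAlgClosed.exists_pow_nat_eq a (n := 2) (by norm_num)
  obtain ⟨β, hβ⟩ := IsAlgClosed.exists_pow_nat_eq c (n := 2) (by norm_num)
  have h1 : (b - 2 * α * β) * (b + 2 * α * β) = 0 := by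
    rw [← hα, ← hβ] at h
    linear_combination h
  rcases mul_eq_zero.1 h1 with h1 | h1
  · exact ⟨α, β, hα.symm, by linear_combination h1, hβ.symm⟩
  · exact ⟨α, -β, hα.symm, by linear_combination h1, by rw [← hβ]; ring⟩

theorem linearForm_vec3 (a b c : ℂ) : linearForm ![a, b, c] = C a * X 0 + C b * X 1 + C c * X 2 := by
  simp [linearForm, Fin.sum_univ_three]

/-- The normal forms of an irreducible conic relative to the line `X 2 = 0`, transversal or
tangent to it. -/
theorem exists_conic_normal_form {Q : MvPolynomial (Fin 3) ℂ} (hQ : Q.IsHomogeneous 2)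
    (hQn : NotLinePair Q) :
    ∃ S : Matrix (Fin 3) (Fin 3) ℂ, S.det ≠ 0 ∧ S 2 = Pi.single 2 1 ∧
      ((∃ e : ℂ, e ≠ 0 ∧ Q = linSubst S (X 0 * X 1 + C e * X 2 ^ 2)) ∨
        Q = linSubst S (X 0 * X 2 + X 1 ^ 2)) := by
  obtain ⟨a, b, c, d, e, f, rfl⟩ := exists_eq_of_isHomogeneous_two hQ
  have hrow : ![(0 : ℂ), 0, 1] = Pi.single 2 1 := by ext i; fin_cases i <;> simp
  -- The discriminant of the restriction to the line `X 2 = 0`: it vanishes in the tangent case.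
  by_cases hdisc : b ^ 2 = 4 * a * c
  · obtain ⟨α, β, rfl, rfl, rfl⟩ := exists_binary_quadratic_square hdisc
    -- If `d X₀ + e X₁` and `α X₀ + β X₁` are dependent, either `X 2` divides the conic or the conic
    -- is a binary form in `α X₀ + β X₁` and `X₂`; in both cases it is a pair of lines.
    by_cases hdet : d * β - e * α = 0
    · exfalso
      obtain ⟨k, hk⟩ : ∃ k, (α = 0 ∧ β = 0) ∨ (d = k * α ∧ e = k * β) := by
        by_cases hα : α = 0
        · by_cases hβ : β = 0
          · exact ⟨0, .inl ⟨hα, hβ⟩⟩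
          · refine ⟨e / β, .inr ⟨?_, by field_simp⟩⟩
            field_simp
            linear_combination hdet
        · refine ⟨d / α, .inr ⟨by field_simp, ?_⟩⟩
          field_simp
          linear_combination -hdet
      rcases hk with ⟨rfl, rfl⟩ | ⟨rfl, rfl⟩
      · refine hQn ![0, 0, 1] ![d, e, f] ?_
        simp only [linearForm_vec3, map_zero, map_one, map_mul, map_pow]
        ring
      · obtain ⟨p, q, r, s, h1, h2, h3⟩ := exists_binary_quadratic_factorization 1 k f
        refine hQn ![p * α, p * β, q] ![r * α, r * β, s] ?_
        have h1' := congrArg (C (σ := Fin 3)) h1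
        simp only [linearForm_vec3, h2, h3, map_one, map_mul, map_pow, map_add, map_ofNat] at h1' ⊢
        linear_combination (C α * X 0 + C β * X 1) ^ 2 * h1'
    · refine ⟨!![d, e, f; α, β, 0; 0, 0, 1], ?_, hrow, .inr ?_⟩
      · rw [det_fin_three]
        simpa using hdet
      · have h0 : (!![d, e, f; α, β, 0; 0, 0, 1] : Matrix _ _ ℂ) 0 = ![d, e, f] := rfl
        have h1 : (!![d, e, f; α, β, 0; 0, 0, 1] : Matrix _ _ ℂ) 1 = ![α, β, 0] := rfl
        have h2 : (!![d, e, f; α, β, 0; 0, 0, 1] : Matrix _ _ ℂ) 2 = ![0, 0, 1] := rfl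
        simp only [map_add, map_mul, map_pow, linSubst_X, h0, h1, h2, linearForm_vec3, map_ofNat,
          map_zero, map_one]
        ring
  · obtain ⟨p, q, r, s, rfl, rfl, rfl⟩ := exists_binary_quadratic_factorization a b c
    have hD : p * s - q * r ≠ 0 := fun h => hdisc (by linear_combination (p * s - q * r) * h)
    -- Complete the product: with `U = p X₀ + q X₁` and `V = r X₀ + s X₁`, the conic is `(U + k
    -- X₂)(V + m X₂) + (f - m k) X₂²`. Cramer's rule gives `m` and `k`.
    obtain ⟨m, k, hd, he⟩ : ∃ m k, d = m * p + k * r ∧ e = m * q + k * s := by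
      refine ⟨(d * s - e * r) / (p * s - q * r), (e * p - d * q) / (p * s - q * r), ?_, ?_⟩ <;>
      · rw [div_mul_eq_mul_div, div_mul_eq_mul_div, ← add_div, eq_div_iff hD]
        ring
    subst hd he
    by_cases hf : f - m * k = 0
    · obtain rfl : f = m * k := by linear_combination hf
      refine (hQn ![p, q, k] ![r, s, m] ?_).elim
      simp only [linearForm_vec3, map_mul, map_add]
      ring
    · refine ⟨!![p, q, k; r, s, m; 0, 0, 1], ?_, hrow, .inl ⟨_, hf, ?_⟩⟩
      · rw [det_fin_three]
        simpa using hD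
      · have h0 : (!![p, q, k; r, s, m; 0, 0, 1] : Matrix _ _ ℂ) 0 = ![p, q, k] := rfl
        have h1 : (!![p, q, k; r, s, m; 0, 0, 1] : Matrix _ _ ℂ) 1 = ![r, s, m] := rfl
        have h2 : (!![p, q, k; r, s, m; 0, 0, 1] : Matrix _ _ ℂ) 2 = ![0, 0, 1] := rfl
        simp only [map_add, map_sub, map_mul, map_pow, linSubst_X, linSubst_C, h0, h1, h2,
          linearForm_vec3, map_zero, map_one]
        ring

/-- One substitution moves the line to `X 2 = 0`; the one normalizing the conic has last row
`Pi.single 2 1`, so it does not disturb the line. -/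
theorem exists_cubic_normal_form {F : MvPolynomial (Fin 3) ℂ} (hF0 : F ≠ 0)
    (hF : SplitsLinearIrreducibleQuadratic F) :
    ∃ (P : Matrix (Fin 3) (Fin 3) ℂ) (q : MvPolynomial (Fin 3) ℂ), P.det ≠ 0 ∧
      F = linSubst P (X 2 * q) ∧ NotLinePair q ∧ ((∃ e : ℂ, e ≠ 0 ∧ q = X 0 * X 1 + C e * X 2 ^ 2) ∨
        q = X 0 * X 2 + X 1 ^ 2) := by
  obtain ⟨L, Q, hL, hQ, hirr, rfl⟩ := hF
  obtain ⟨w, rfl⟩ := exists_eq_linearForm hL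
  have hw : w ≠ 0 := by
    rintro rfl
    simp [linearForm_zero] at hF0
  obtain ⟨P, hP, rfl⟩ := exists_det_ne_zero_row_eq hw 2
  have hQP : Q = linSubst P (linSubst P⁻¹ Q) := by
    rw [linSubst_linSubst, nonsing_inv_mul _ (isUnit_iff_ne_zero.2 hP), linSubst_one]
  have hn := notLinePair_of_irreducible hirr
  rw [hQP] at hn
  obtain ⟨S, hS, hS2, hq⟩ := exists_conic_normal_form (linSubst_isHomogeneous hQ P⁻¹) hn.of_linSubst
  have key : ∀ q, linSubst P⁻¹ Q = linSubst S q →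
      linearForm (P 2) * Q = linSubst (S * P) (X 2 * q) ∧ NotLinePair q := by
    intro q hq
    refine ⟨?_, (hq ▸ hn.of_linSubst).of_linSubst⟩
    rw [map_mul, ← linSubst_linSubst P S q, ← hq, ← hQP, linSubst_X]
    congr 2
    ext j
    simp [Matrix.mul_apply, hS2, Pi.single_apply]
  have hSP : (S * P).det ≠ 0 := by rw [det_mul]; exact mul_ne_zero hS hP
  rcases hq with ⟨e, he, hq⟩ | hq
  · exact ⟨S * P, _, hSP, (key _ hq).1, (key _ hq).2, .inl ⟨e, he, rfl⟩⟩
  · exact ⟨S * P, _, hSP, (key _ hq).1, (key _ hq).2, .inr rfl⟩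

/-! ### Symmetry groups of the normal forms -/

/-- A linear symmetry of a line and an irreducible conic preserves the line and the conic. -/
theorem preserves_line_and_conic {q : MvPolynomial (Fin 3) ℂ} (hq : q.IsHomogeneous 2)
    (hn : NotLinePair q) {B : Matrix (Fin 3) (Fin 3) ℂ} (hB : B.det ≠ 0)
    (h : linSubst B (X 2 * q) = X 2 * q) :
    B 2 0 = 0 ∧ B 2 1 = 0 ∧ ∀ x, B 2 2 * eval (B *ᵥ x) q = eval x q := by
  have hBu := isUnit_iff_ne_zero.2 hB
  have hdvd : X 2 ∣ linSubst B (X 2) * linSubst B q := ⟨q, by rw [← map_mul, h]⟩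
  -- `X 2` is prime. If it divided the transformed conic, transforming back by `B⁻¹` would split `q`
  -- into linear forms.
  have h1 : X 2 ∣ linSubst B (X 2) := by
    refine (X_prime.dvd_or_dvd hdvd).resolve_right ?_
    rintro ⟨R, hR⟩
    have hRh : R.IsHomogeneous 1 :=
      isHomogeneous_of_X_mul (i := 2) (hR ▸ linSubst_isHomogeneous hq B)
    obtain ⟨u, rfl⟩ := exists_eq_linearForm hRh
    apply hn (B⁻¹ 2) (u ᵥ* B⁻¹)
    rw [← linSubst_X, ← linSubst_linearForm, ← map_mul, ← hR, linSubst_linSubst,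
      mul_nonsing_inv _ hBu, linSubst_one]
  obtain ⟨R, hR⟩ := h1
  rw [linSubst_X] at hR
  have h20 : B 2 0 = 0 := by
    simpa [eval_linearForm] using congrArg (eval (Pi.single 0 1)) hR
  have h21 : B 2 1 = 0 := by
    simpa [eval_linearForm] using congrArg (eval (Pi.single 1 1)) hR
  refine ⟨h20, h21, fun x => ?_⟩
  have hl : linearForm (B 2) = C (B 2 2) * X 2 := by
    simp [linearForm, Fin.sum_univ_three, h20, h21]
  rw [map_mul, linSubst_X, hl, mul_comm (C _), mul_assoc] at h
  have := congrArg (eval x) (mul_left_cancel₀ (X_ne_zero 2) h)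
  rwa [map_mul, eval_C, eval_linSubst] at this

theorem transversal_symmetry_iff {e : ℂ} (he : e ≠ 0)
    (hn : NotLinePair (X 0 * X 1 + C e * X 2 ^ 2 : MvPolynomial (Fin 3) ℂ))
    (B : Matrix (Fin 3) (Fin 3) ℂ) :
    (B.det = 1 ∧ linSubst B (X 2 * (X 0 * X 1 + C e * X 2 ^ 2)) =
        X 2 * (X 0 * X 1 + C e * X 2 ^ 2)) ↔
      ∃ μ s : ℂ, μ ^ 3 = 1 ∧ s ≠ 0 ∧ B = !![s, 0, 0; 0, (μ * s)⁻¹, 0; 0, 0, μ] := by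
  constructor
  · rintro ⟨hdet, h⟩
    have hh : (X 0 * X 1 + C e * X 2 ^ 2 : MvPolynomial (Fin 3) ℂ).IsHomogeneous 2 :=
      ((isHomogeneous_X _ _).mul (isHomogeneous_X _ _)).add (isHomogeneous_C_mul_X_pow _ _ _)
    obtain ⟨h20, h21, H⟩ := preserves_line_and_conic hh hn (by simp [hdet]) h
    have H' : ∀ x y z, B 2 2 * ((B 0 0 * x + B 0 1 * y + B 0 2 * z) *
        (B 1 0 * x + B 1 1 * y + B 1 2 * z) + e * (B 2 2 * z) ^ 2) = x * y + e * z ^ 2 := by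
      intro x y z
      simpa [mulVec, dotProduct, Fin.sum_univ_three, h20, h21] using H ![x, y, z]
    have h1 := H' 1 0 0
    have h2 := H' 0 1 0
    have h3 := H' 0 0 1
    have h4 := H' 1 1 0
    have h5 := H' 1 0 1
    have h6 := H' 0 1 1
    simp only [det_fin_three, h20, h21, mul_one, mul_zero, add_zero, zero_add, sub_zero, ne_eq,
      OfNat.ofNat_ne_zero, not_false_eq_true, zero_pow] at hdet h1 h2 h3 h4 h5 h6
    have hμ0 : B 2 2 ≠ 0 := fun h => by simp [h] at hdet
    -- This excludes the symmetries interchanging `X 0` and `X 1`: they would have determinant `-1`.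
    have ha : B 0 0 ≠ 0 := by
      intro h
      rw [h] at hdet h4
      grind
    have h10 : B 1 0 = 0 := by grind
    have h11 : B 1 1 ≠ 0 := by
      intro h
      simp [h, h10] at hdet
    have h01 : B 0 1 = 0 := by grind
    have h12 : B 1 2 = 0 := by grind
    have h02 : B 0 2 = 0 := by grind
    refine ⟨B 2 2, B 0 0, ?_, ha, ?_⟩
    · simp only [h02, zero_mul, zero_add] at h3
      exact mul_left_cancel₀ he (by linear_combination h3)
    · have hinv : B 1 1 = (B 2 2 * B 0 0)⁻¹ := by
        rw [h10] at hdet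
        exact eq_inv_of_mul_eq_one_left (by linear_combination hdet)
      ext i j
      fin_cases i <;> fin_cases j <;> simp [h01, h02, h10, h12, h20, h21, hinv]
  · rintro ⟨μ, s, hμ, hs, rfl⟩
    have hμ0 : μ ≠ 0 := by rintro rfl; simp at hμ
    constructor
    · rw [det_fin_three]
      simp
      field_simp
    · refine MvPolynomial.funext fun x => ?_
      simp [eval_linSubst, dotProduct, Fin.sum_univ_three]
      field_simp
      linear_combination x 2 ^ 3 * e * hμ

theorem tangent_symmetry_iff
    (hn : NotLinePair (X 0 * X 2 + X 1 ^ 2 : MvPolynomial (Fin 3) ℂ))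
    (B : Matrix (Fin 3) (Fin 3) ℂ) :
    (B.det = 1 ∧ linSubst B (X 2 * (X 0 * X 2 + X 1 ^ 2)) = X 2 * (X 0 * X 2 + X 1 ^ 2)) ↔
      ∃ μ s : ℂ, μ ^ 3 = 1 ∧ B = !![μ, -2 * s, -μ ^ 2 * s ^ 2; 0, μ, s; 0, 0, μ] := by
  constructor
  · rintro ⟨hdet, h⟩
    have hh : (X 0 * X 2 + X 1 ^ 2 : MvPolynomial (Fin 3) ℂ).IsHomogeneous 2 :=
      ((isHomogeneous_X _ _).mul (isHomogeneous_X _ _)).add (isHomogeneous_X_pow _ _)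
    obtain ⟨h20, h21, H⟩ := preserves_line_and_conic hh hn (by simp [hdet]) h
    have H' : ∀ x y z, B 2 2 * ((B 0 0 * x + B 0 1 * y + B 0 2 * z) * (B 2 2 * z) +
        (B 1 0 * x + B 1 1 * y + B 1 2 * z) ^ 2) = x * z + y ^ 2 := by
      intro x y z
      simpa [mulVec, dotProduct, Fin.sum_univ_three, h20, h21] using H ![x, y, z]
    have h1 := H' 1 0 0
    have h2 := H' 0 1 0
    have h3 := H' 0 0 1
    have h5 := H' 1 0 1
    have h6 := H' 0 1 1
    simp only [det_fin_three, h20, h21, mul_one, mul_zero, add_zero, zero_add, sub_zero, ne_eq,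
      OfNat.ofNat_ne_zero, not_false_eq_true, zero_pow, one_pow] at hdet h1 h2 h3 h5 h6
    have hμ0 : B 2 2 ≠ 0 := fun h => by simp [h] at hdet
    have h10 : B 1 0 = 0 := by simpa [hμ0] using h1
    simp only [h10, zero_mul, mul_zero, zero_add, sub_zero] at hdet h5
    have h00 : B 2 2 ^ 2 * B 0 0 = 1 := by linear_combination h5 - h3
    -- Compare the determinant `B 0 0 * B 1 1 * B 2 2 = 1` with `h00`. The `X 1 ^ 2` coefficient
    -- then gives `μ ^ 3 = 1`.
    have h11 : B 1 1 = B 2 2 := by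
      linear_combination B 2 2 * hdet - B 1 1 * h00
    rw [h11] at h2 h6
    have hμ : B 2 2 ^ 3 = 1 := by linear_combination h2
    have h00' : B 0 0 = B 2 2 := by linear_combination B 2 2 * h00 - B 0 0 * hμ
    have h01 : B 0 1 = -2 * B 1 2 := by
      refine mul_left_cancel₀ (pow_ne_zero 2 hμ0) ?_
      linear_combination h6 - h3 - h2
    have h02 : B 0 2 = -B 2 2 ^ 2 * B 1 2 ^ 2 := by
      refine mul_left_cancel₀ (pow_ne_zero 2 hμ0) ?_
      linear_combination h3 + B 2 2 * B 1 2 ^ 2 * hμ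
    refine ⟨B 2 2, B 1 2, hμ, ?_⟩
    ext i j
    fin_cases i <;> fin_cases j <;> simp [h10, h20, h21, h00', h01, h02, h11]
  · rintro ⟨μ, s, hμ, rfl⟩
    constructor
    · rw [det_fin_three]
      simp
      linear_combination hμ
    · refine MvPolynomial.funext fun x => ?_
      simp [eval_linSubst, dotProduct, Fin.sum_univ_three]
      linear_combination (x 0 * x 2 ^ 2 + x 1 ^ 2 * x 2 - μ * x 2 ^ 3 * s ^ 2) * hμ

/-! ### Lie structure from a parametrization -/

/-- The linear map `M ↦ P M Q` between spaces of matrices. -/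
noncomputable def mulLeftRight {n : ℕ} (P Q : Matrix (Fin n) (Fin n) ℂ) :
    (Fin n → Fin n → ℂ) →L[ℂ] (Fin n → Fin n → ℂ) :=
  LinearMap.toContinuousLinearMap
    { toFun := fun M => P * of M * Q
      map_add' := fun M N => by
        change P * (of M + of N) * Q = _
        rw [Matrix.mul_add, Matrix.add_mul]; rfl
      map_smul' := fun c M => by
        change P * (c • of M) * Q = _
        rw [Matrix.mul_smul, Matrix.smul_mul]; rfl }

/-- If the symmetries of a form are, in suitable coordinates, the matrices `N μ s` with `μ ^ 3 = 1`
and `s ∈ U`, holomorphic in `s`, of which `s` and `μ` are entries, then they are a complex Lie group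
of dimension one. -/
theorem isLieSubgroupOfDim_one_of_parametrization {F F' : MvPolynomial (Fin 3) ℂ}
    {P : Matrix (Fin 3) (Fin 3) ℂ} (hP : P.det ≠ 0) (hF : F = linSubst P F') {U : Set ℂ}
    (hU : IsOpen U) (i j : Fin 3) (N : ℂ → ℂ → Matrix (Fin 3) (Fin 3) ℂ)
    (hN : ∀ B : Matrix (Fin 3) (Fin 3) ℂ, (B.det = 1 ∧ linSubst B F' = F') ↔
      ∃ μ s : ℂ, μ ^ 3 = 1 ∧ s ∈ U ∧ B = N μ s)
    (hs : ∀ μ s, N μ s i j = s) (hμ : ∀ μ s, N μ s 2 2 = μ)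
    (hd : ∀ μ s, μ ≠ 0 → s ∈ U → ∀ k m,
      ContDiffAt ℂ ω (fun t => N μ t k m) s) :
    IsLieSubgroupOfDim (symmetryGroupSL F) 1 := by
  have hPu := isUnit_iff_ne_zero.2 hP
  have hconj : ∀ A : Matrix (Fin 3) (Fin 3) ℂ, P⁻¹ * (P * A * P⁻¹) * P = A := fun A => by
    rw [Matrix.mul_assoc P, nonsing_inv_mul_cancel_left _ _ hPu,
      nonsing_inv_mul_cancel_right _ _ hPu]
  have hconj' : ∀ A : Matrix (Fin 3) (Fin 3) ℂ, P * (P⁻¹ * A * P) * P⁻¹ = A := fun A => by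
    rw [mul_mul_inv_mul_mul_mul_inv hP, mul_nonsing_inv_cancel_right _ _ hPu]
  have hdet : ∀ A : Matrix (Fin 3) (Fin 3) ℂ, (P * A * P⁻¹).det = A.det := fun A => by
    rw [det_mul, det_mul, mul_right_comm, det_nonsing_inv, Ring.mul_inverse_cancel _ hPu, one_mul]
  have hmem : ∀ A : Matrix (Fin 3) (Fin 3) ℂ,
      linSubst A F = F ↔ linSubst (P * A * P⁻¹) F' = F' := by
    intro A
    have h1 : linSubst A (linSubst P F') = linSubst P (linSubst (P * A * P⁻¹) F') := by
      rw [linSubst_linSubst, linSubst_linSubst, nonsing_inv_mul_cancel_right _ _ hPu]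
    rw [hF, h1, (linSubst_injective (mul_nonsing_inv P hPu)).eq_iff]
  have hpar : ∀ A : symmetryGroupSL F, ∃ μ s : ℂ, μ ^ 3 = 1 ∧ s ∈ U ∧
      mulLeftRight P P⁻¹ (matrixInclusion _ A) = N μ s := fun A =>
    (hN _).1 ⟨(hdet _).trans A.1.2, (hmem _).1 (mem_symmetryGroupSL_iff.1 A.2)⟩
  let l : (Fin 3 → Fin 3 → ℂ) →L[ℂ] (Fin 1 → ℂ) := ContinuousLinearMap.pi fun _ =>
    (ContinuousLinearMap.proj j ∘L ContinuousLinearMap.proj (R := ℂ) (φ := fun _ => Fin 3 → ℂ) i) ∘L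
      mulLeftRight P P⁻¹
  have hl : ∀ M, l M = fun _ => mulLeftRight P P⁻¹ M i j := fun M => rfl
  refine isLieSubgroupOfDim_of_sections _ l fun A => ?_
  obtain ⟨μ, s, hμ3, hsU, hA⟩ := hpar A
  have hμ0 : μ ≠ 0 := by rintro rfl; simp at hμ3
  have hlA : l (matrixInclusion _ A) = fun _ => s := by
    rw [hl, hA, hs]
  -- The local section freezes the cube root of unity `μ` at its value at `A` and lets only `s`
  -- vary.
  refine ⟨fun t => mulLeftRight P⁻¹ P (N μ (t 0)), ?_, ?_, ?_⟩
  · rw [hlA]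
    exact (mulLeftRight P⁻¹ P).contDiff.contDiffAt.comp (fun _ : Fin 1 => s)
      (ContDiffAt.comp (fun _ : Fin 1 => s) (f := fun t : Fin 1 → ℂ => t 0)
        (contDiffAt_pi.2 fun k => contDiffAt_pi.2 fun m => hd μ s hμ0 hsU k m)
        (contDiff_apply ℂ ℂ (0 : Fin 1)).contDiffAt)
  -- The other cube roots form a finite, hence closed, set; by continuity of the entry `(2, 2)`,
  -- elements near `A` have the same `μ`.
  · have hfin : {z : ℂ | z ^ 3 = 1 ∧ z ≠ μ}.Finite := by
      refine Set.Finite.subset (Polynomial.nthRoots 3 (1 : ℂ)).toFinset.finite_toSet ?_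
      rintro z ⟨hz, -⟩
      simp [Polynomial.mem_nthRoots, hz]
    have hcont : Continuous fun B : symmetryGroupSL F =>
        mulLeftRight P P⁻¹ (matrixInclusion _ B) 2 2 :=
      (continuous_apply 2).comp ((continuous_apply 2).comp
        ((mulLeftRight P P⁻¹).continuous.comp (continuous_matrixInclusion _)))
    filter_upwards [hcont.continuousAt.eventually
      (hfin.isClosed.isOpen_compl.mem_nhds (by simp [hA, hμ]))] with B hB
    obtain ⟨ν, r, hν, hr, hBN⟩ := hpar B
    obtain rfl : ν = μ := by
      by_contra hne
      exact hB ⟨by rw [hBN, hμ, hν], by rwa [hBN, hμ]⟩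
    simp only [hl, hBN, hs]
    rw [← hBN]
    exact hconj _
  · rw [hlA]
    have hc : ContinuousAt (fun t : Fin 1 → ℂ => t 0) fun _ => s :=
      (continuous_apply 0).continuousAt
    filter_upwards [hc.eventually (hU.mem_nhds hsU)] with t ht
    obtain ⟨h1, h2⟩ := (hN (N μ (t 0))).2 ⟨μ, t 0, hμ3, ht, rfl⟩
    refine ⟨⟨⟨P⁻¹ * N μ (t 0) * P, by rw [← hdet, hconj', h1]⟩,
      mem_symmetryGroupSL_iff.2 ((hmem _).2 (by rw [hconj', h2]))⟩, rfl, ?_⟩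
    have h3 : mulLeftRight P P⁻¹ (mulLeftRight P⁻¹ P (N μ (t 0))) = N μ (t 0) := hconj' _
    rw [hl, h3, hs]
    ext k
    rw [Fin.fin_one_eq_zero k]

/-- The coordinate `s` is the entry `(0, 0)`, ranging over the nonzero numbers, in the transversal
case, and the entry `(1, 2)`, ranging over all of `ℂ`, in the tangent case. -/
theorem isLieSubgroupOfDim_one_of_splits {F : MvPolynomial (Fin 3) ℂ} (hF0 : F ≠ 0)
    (hF : SplitsLinearIrreducibleQuadratic F) : IsLieSubgroupOfDim (symmetryGroupSL F) 1 := by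
  obtain ⟨P, q, hP, hFP, hn, ⟨e, he, rfl⟩ | rfl⟩ := exists_cubic_normal_form hF0 hF
  · refine isLieSubgroupOfDim_one_of_parametrization hP hFP isOpen_compl_singleton 0 0
      (fun μ s => !![s, 0, 0; 0, (μ * s)⁻¹, 0; 0, 0, μ]) (transversal_symmetry_iff he hn)
      (fun _ _ => rfl) (fun _ _ => rfl) fun μ s hμ hs i j => ?_
    have hinv : ContDiffAt ℂ ω (fun t : ℂ => (μ * t)⁻¹) s :=
      (contDiffAt_const.mul contDiffAt_id).inv (mul_ne_zero hμ hs)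
    fin_cases i <;> fin_cases j
    all_goals first | exact contDiffAt_const | exact contDiffAt_id | exact hinv
  · refine isLieSubgroupOfDim_one_of_parametrization hP hFP isOpen_univ 1 2
      (fun μ s => !![μ, -2 * s, -μ ^ 2 * s ^ 2; 0, μ, s; 0, 0, μ])
      (fun B => (tangent_symmetry_iff hn B).trans (by simp))
      (fun _ _ => rfl) (fun _ _ => rfl) fun μ s _ _ i j => ?_
    fin_cases i <;> fin_cases j
    all_goals first
      | exact contDiffAt_const
      | exact contDiffAt_id
      | exact contDiffAt_const.mul contDiffAt_id
      | exact contDiffAt_const.mul (contDiffAt_id.pow 2)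

end TernaryCubic

theorem mainTheorem3 (F : MvPolynomial (Fin 3) ℂ) (hF : F.IsHomogeneous 3) (hF0 : F ≠ 0) :
    SplitsLinearIrreducibleQuadratic F ↔ IsLieSubgroupOfDim (symmetryGroupSL F) 1 :=
  ⟨TernaryCubic.isLieSubgroupOfDim_one_of_splits hF0,
    TernaryCubic.splits_of_isLieSubgroupOfDim_one hF hF0⟩
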